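/- Let $N\ge 1$ be an integer, $s\in(0,1)$, $\beta>0$ and $\psi(x)=(1+|x|^2)^{-\beta/2}$ for $x\in\mathbb R^N$. Let $$\mathcal L^s(\mathbb R^N)=\Big\{u:\mathbb R^N\to\mathbb R\ \text{measurable}:\ \int_{\mathbb R^N}\frac{|u(x)|}{1+|x|^{N+2s}}\,dx<\infty\Big\},$$ $$L^p_\psi(\mathbb R^N)=\Big\{u:\mathbb R^N\to\mathbb R\ \text{measurable}:\ \int_{\mathbb R^N}|u|^p\psi\,dx<\infty\Big\}.$$ A solution of $(-\Delta)^su+\rho cu=0$ in $\mathbb R^N$ is a function $u\in\mathcal L^s(\mathbb R^N)$ which for some $\gamma>0$ belongs to $C^{2s+\gamma}_{loc}(\mathbb R^N)$ if $s<\frac12$, or to $C^{1,2s+\gamma-1}_{loc}(\mathbb R^N)$ if $s\ge\frac12$, and which satisfies, for every $x\in\mathbb R^N$, $$C_{N,s}\,\mathrm{P.V.}\!\int_{\mathbb R^N}\frac{u(x)-u(y)}{|x-y|^{N+2s}}\,dy+\rho(x)c(x)u(x)=0,\qquad C_{N,s}=\frac{2^{2s-1}\,2s\,\Gamma((N+2s)/2)}{\pi^{N/2}\,\Gamma(1-s)}.$$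 **Theorem 2.8.** Let $\rho\in C(\mathbb R^N)$ with $\rho>0$, and let $K>0$, $\alpha\in\mathbb R$ be such that $$\rho(x)\ge K(1+|x|^2)^{-\alpha/2}\quad\text{for all }x\in\mathbb R^N. \tag{1}$$ Let $c\in C(\mathbb R^N)$ with $c\ge 0$ and $c(x)\ge c_0$ for all $x\in\mathbb R^N$, for some $c_0>0$. Let $p\ge1$ and let $u$ be a solution of $(-\Delta)^su+\rho cu=0$ in $\mathbb R^N$ with $|u|^p\in\mathcal L^s(\mathbb R^N)$ and $u\in L^p_\psi(\mathbb R^N)$. Then $u\equiv0$ in $\mathbb R^N$, provided that one of the following holds: (i) $0<\beta\le N-2s$ and $\alpha\in\mathbb R$; (ii) $N-2s<\beta<N$, $\alpha\le 2s$, and $p\,c_0K$ is large enough; (iii) $\beta=N$, $p\,c_0K$ is large enough, and either $\alpha<2s$, or instead of (1) there holds $\rho(x)\ge K(1+|x|^2)^{-s}\log(1+|x|^2)$ for all $x\in\mathbb R^N$; (iv) $\beta>N$, $\alpha+\beta\le 2s+N$, and $p\,c_0K$ is large enough. Here "$p\,c_0K$ is large enough" means $p\,c_0K\ge\Lambda$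 for a constant $\Lambda$ that depends only on $N,s,\alpha,\beta$ (only on $N,s$ under the second alternative of (iii)), and not on $\rho,c,u,p,c_0,K$ otherwise. -/

import Mathlib

open MeasureTheory Filter Topology
open scoped NNReal

namespace FracElliptic

/-- The normalising constant
`C_{N,s} = 2^{2s-1} 2s Γ((N+2s)/2) / (π^{N/2} Γ(1-s))` of the fractional Laplacian. -/
noncomputable def fracConst (N : ℕ) (s : ℝ) : ℝ :=
  2 ^ (2 * s - 1) * (2 * s) * Real.Gamma (((N : ℝ) + 2 * s) / 2) /
    (Real.pi ^ ((N : ℝ) / 2) * Real.Gamma (1 - s))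

/-- The space `𝓛^s(ℝ^N)`: measurable functions with `∫ |u(x)| / (1 + |x|^{N+2s}) dx < ∞`. -/
def MemLs {N : ℕ} (s : ℝ) (u : EuclideanSpace ℝ (Fin N) → ℝ) : Prop :=
  AEMeasurable u ∧
    Integrable (fun x : EuclideanSpace ℝ (Fin N) => |u x| / (1 + ‖x‖ ^ ((N : ℝ) + 2 * s)))

/-- The weight `ψ(x) = (1 + |x|²)^{-β/2}`. -/
noncomputable def weight {N : ℕ} (β : ℝ) (x : EuclideanSpace ℝ (Fin N)) : ℝ :=
  (1 + ‖x‖ ^ 2) ^ (-β / 2)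

/-- The space `L^p_ψ(ℝ^N)`: measurable functions with `∫ |u(x)|^p ψ(x) dx < ∞`. -/
def MemLpWeight {N : ℕ} (β p : ℝ) (u : EuclideanSpace ℝ (Fin N) → ℝ) : Prop :=
  AEMeasurable u ∧ Integrable (fun x : EuclideanSpace ℝ (Fin N) => |u x| ^ p * weight β x)

/-- Hölder continuity with exponent `θ` on every compact set. -/
def LocHolder {E F : Type*} [PseudoEMetricSpace E] [PseudoEMetricSpace F]
    (θ : ℝ≥0) (f : E → F) : Prop :=
  ∀ S : Set E, IsCompact S → ∃ C : ℝ≥0, HolderOnWith C θ f S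

/-- The regularity class of solutions: `C^{2s+γ}_loc` for some `γ > 0` if `s < 1/2`
(here `θ = 2s + γ`), and `C^{1,2s+γ-1}_loc` for some `γ > 0` if `s ≥ 1/2`
(here `θ = 2s + γ - 1`). As the classes decrease in `γ`, one may take `θ ≤ 1`. -/
def Regular {N : ℕ} (s : ℝ) (u : EuclideanSpace ℝ (Fin N) → ℝ) : Prop :=
  (s < 1 / 2 → ∃ θ : ℝ≥0, 2 * s < (θ : ℝ) ∧ θ ≤ 1 ∧ LocHolder θ u) ∧
  (1 / 2 ≤ s → ContDiff ℝ 1 u ∧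
    ∃ θ : ℝ≥0, 2 * s - 1 < (θ : ℝ) ∧ θ ≤ 1 ∧ LocHolder θ (fderiv ℝ u))

/-- `HasFracLaplacianAt s u x L` says that the principal value
`C_{N,s} P.V. ∫ (u(x) - u(y)) / |x - y|^{N+2s} dy` exists and equals `L`. -/
def HasFracLaplacianAt {N : ℕ} (s : ℝ) (u : EuclideanSpace ℝ (Fin N) → ℝ)
    (x : EuclideanSpace ℝ (Fin N)) (L : ℝ) : Prop :=
  Tendsto
    (fun ε : ℝ => fracConst N s *
      ∫ y in (Metric.ball x ε)ᶜ, (u x - u y) / ‖x - y‖ ^ ((N : ℝ) + 2 * s))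
    (𝓝[>] 0) (𝓝 L)

/-- `u` is a solution of `(-Δ)^s u + ρ c u = 0` in `ℝ^N`. -/
structure IsSolution {N : ℕ} (s : ℝ) (ρ c u : EuclideanSpace ℝ (Fin N) → ℝ) : Prop where
  memLs : MemLs s u
  regular : Regular s u
  equation : ∀ x, ∃ L : ℝ, HasFracLaplacianAt s u x L ∧ L + ρ x * c x * u x = 0

/-- `ρ` is continuous and positive. -/
def IsDensity {N : ℕ} (ρ : EuclideanSpace ℝ (Fin N) → ℝ) : Prop :=
  Continuous ρ ∧ ∀ x, 0 < ρ x

/-- `ρ(x) ≥ K (1 + |x|²)^{-α/2}` for all `x`. -/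
def PowerLowerBound {N : ℕ} (α K : ℝ) (ρ : EuclideanSpace ℝ (Fin N) → ℝ) : Prop :=
  ∀ x, K * (1 + ‖x‖ ^ 2) ^ (-α / 2) ≤ ρ x

/-- `ρ(x) ≥ K (1 + |x|²)^{-s} log(1 + |x|²)` for all `x`. -/
def LogLowerBound {N : ℕ} (s K : ℝ) (ρ : EuclideanSpace ℝ (Fin N) → ℝ) : Prop :=
  ∀ x, K * (1 + ‖x‖ ^ 2) ^ (-s) * Real.log (1 + ‖x‖ ^ 2) ≤ ρ x

/-- Uniqueness in `L^p_ψ` for a given density `ρ`, for all continuous nonnegative `c ≥ c₀`: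
every solution `u` with `|u|^p ∈ 𝓛^s` and `u ∈ L^p_ψ` vanishes identically. -/
def UniquenessHolds {N : ℕ} (s β p c₀ : ℝ) (ρ : EuclideanSpace ℝ (Fin N) → ℝ) : Prop :=
  ∀ c : EuclideanSpace ℝ (Fin N) → ℝ,
    Continuous c → (∀ x, 0 ≤ c x) → (∀ x, c₀ ≤ c x) →
    ∀ u : EuclideanSpace ℝ (Fin N) → ℝ,
      IsSolution s ρ c u → MemLs s (fun x => |u x| ^ p) → MemLpWeight β p u →
      ∀ x, u x = 0

end FracElliptic

/-! Formally, multiply the equation by `p |u|^{p-1} sign u`. Convexity gives `(-Δ)^s |u|^p ≤ p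
|u|^{p-1} sign(u) (-Δ)^s u = -p ρ c |u|^p`. Pairing with a compactly supported `φ ≥ 0` and moving
the operator onto `φ` yields `p ∫ ρ c φ |u|^p ≤ ∫ |u|^p (-(-Δ)^s φ)`. It remains to find `φ` for
which the right side is small compared with the left.

The rigorous version (`IsSolution.integral_test_le`) works with kernels truncated to `|x - y| ≥ ε`:
convexity and symmetry are elementary there, and only the truncations of `u` itself have to converge
as `ε → 0`. Thus `|u|^p` needs no fractional Laplacian of its own, and `φ` may have a kink.

The test function is `min(1, |x|^{-β})` with a smooth cutoff at radius `R`. On the unit ball it is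
maximal, so its truncated Laplacians are nonnegative. For `|x| ≥ 1`, second differences control the
part `|z| < |x|/2`, and the far part is controlled by the mass of the barrier in the ball of radius
`|x|`. Uniformly in `R ≥ 2` and `ε`, the negative part is at most a constant times `|x|^{-β-2s}` if
`β < N`, `|x|^{-N-2s} (1 + log |x|)` if `β = N`, and `|x|^{-N-2s}` if `β > N`. The assumptions on
`α` say exactly that `ρ |x|^{-β}` dominates this rate. If `p c₀ K` is large, the resulting
inequality `∫ ρ φ |u|^p ≤ θ ∫ ρ φ |u|^p` has `θ < 1` and forces `u = 0`; see
`IsSolution.eq_zero_of_dominated`.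

For `β ≤ N - 2s` the exponent `N - 2s` of the fundamental solution is used instead. Its barrier is
superharmonic for every truncation (`truncFL_barrier_nonneg`, by inversion in a sphere), so negative
contributions come only from `|x| > R/2`. There they are `O(|x|^{-N})`, which is integrable against
`|u|^p`, and they vanish as `R → ∞`; no largeness is needed. -/

namespace FracElliptic

/-! ### Truncated kernels and integrability against them -/

/-- Euclidean space `ℝ^N`. -/
abbrev Eucl (N : ℕ) := EuclideanSpace ℝ (Fin N)

/-- The kernel `|z|^{-q}`, truncated to `|z| ≥ ε`. -/
noncomputable def truncKernel {N : ℕ} (q ε : ℝ) (z : Eucl N) : ℝ :=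
  if ε ≤ ‖z‖ then 1 / ‖z‖ ^ q else 0

/-- The truncated (unnormalised) fractional Laplacian. -/
noncomputable def truncFL {N : ℕ} (q ε : ℝ) (g : Eucl N → ℝ) (x : Eucl N) : ℝ :=
  ∫ y, (g x - g y) * truncKernel q ε (x - y)

theorem setIntegral_eq_truncFL {N : ℕ} (q ε : ℝ) (g : Eucl N → ℝ) (x : Eucl N) :
    ∫ y in (Metric.ball x ε)ᶜ, (g x - g y) / ‖x - y‖ ^ q = truncFL q ε g x := by
  rw [truncFL, ← integral_indicator Metric.isOpen_ball.measurableSet.compl]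
  congr 1
  ext y
  by_cases h : ε ≤ ‖x - y‖
  · have : y ∈ (Metric.ball x ε)ᶜ := by
      simpa [dist_comm y x, dist_eq_norm] using h
    rw [Set.indicator_of_mem this, truncKernel, if_pos h]; ring
  · have : y ∉ (Metric.ball x ε)ᶜ := by
      simpa [dist_comm y x, dist_eq_norm] using h
    rw [Set.indicator_of_notMem this, truncKernel, if_neg h]; ring

theorem truncKernel_nonneg {N : ℕ} (q ε : ℝ) (z : Eucl N) : 0 ≤ truncKernel q ε z := by
  unfold truncKernel; split_ifs <;> positivity

theorem truncKernel_neg {N : ℕ} (q ε : ℝ) (z : Eucl N) :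
    truncKernel q ε (-z) = truncKernel q ε z := by
  simp [truncKernel]

theorem truncKernel_sub_comm {N : ℕ} (q ε : ℝ) (x y : Eucl N) :
    truncKernel q ε (x - y) = truncKernel q ε (y - x) := by
  rw [← truncKernel_neg, neg_sub]

theorem measurable_truncKernel {N : ℕ} (q ε : ℝ) :
    Measurable (truncKernel q ε : Eucl N → ℝ) := by
  unfold truncKernel
  refine Measurable.ite (measurableSet_le measurable_const measurable_norm) ?_ measurable_const
  exact measurable_const.div (measurable_norm.pow_const q)

theorem one_add_rpow_le {q t : ℝ} (hq : 0 ≤ q) (ht : 0 ≤ t) : 1 + t ^ q ≤ 2 * (1 + t) ^ q := by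
  have h1 : (1 : ℝ) ≤ (1 + t) ^ q := Real.one_le_rpow (by linarith) hq
  have h2 : t ^ q ≤ (1 + t) ^ q := Real.rpow_le_rpow ht (by linarith) hq
  linarith

/-- On the support of the kernel, `1 + |y| ≤ 1 + R + |x - y| ≤ ((1 + R)/ε + 1) |x - y|`. The
constant is uniform over `|x| ≤ R`, which later gives an integrable majorant independent of `x`. -/
theorem truncKernel_sub_le {N : ℕ} {q ε R : ℝ} (hq : 0 ≤ q) (hε : 0 < ε) (hR : 0 ≤ R)
    {x : Eucl N} (hx : ‖x‖ ≤ R) (y : Eucl N) :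
    truncKernel q ε (x - y) ≤ 2 * ((1 + R) / ε + 1) ^ q * (1 / (1 + ‖y‖ ^ q)) := by
  have hA : 0 ≤ (1 + R) / ε + 1 := by positivity
  unfold truncKernel
  split_ifs with h
  · have hd : 0 < ‖x - y‖ := lt_of_lt_of_le hε h
    have h1 : 1 + ‖y‖ ≤ ((1 + R) / ε + 1) * ‖x - y‖ := by
      have e1 : ‖y‖ ≤ ‖x‖ + ‖x - y‖ := by
        have := norm_sub_le x (x - y); simpa using this
      have e2 : 1 + R ≤ (1 + R) / ε * ‖x - y‖ := by
        rw [div_mul_eq_mul_div, le_div_iff₀ hε]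
        gcongr
      linarith
    have h2 : 1 + ‖y‖ ^ q ≤ 2 * (((1 + R) / ε + 1) ^ q * ‖x - y‖ ^ q) := by
      refine (one_add_rpow_le hq (norm_nonneg y)).trans ?_
      rw [← Real.mul_rpow hA hd.le]
      gcongr
    have h3 : 0 < ‖x - y‖ ^ q := Real.rpow_pos_of_pos hd q
    rw [mul_one_div, div_le_div_iff₀ h3 (by positivity)]
    linarith
  · positivity

theorem integrable_one_div_one_add_rpow {N : ℕ} {q : ℝ} (hq : (N : ℝ) < q) :
    Integrable (fun y : Eucl N => 1 / (1 + ‖y‖ ^ q)) := by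
  have hq0 : 0 < q := lt_of_le_of_lt (Nat.cast_nonneg N) hq
  have h := (integrable_one_add_norm (E := Eucl N) (μ := volume) (r := q)
    (by simpa using hq)).const_mul (2 ^ q)
  refine h.mono' ?_ (Eventually.of_forall fun y => ?_)
  · exact (measurable_const.div
      (measurable_const.add (measurable_norm.pow_const q))).aestronglyMeasurable
  · rw [Real.norm_of_nonneg (by positivity), Real.rpow_neg (by positivity), ← div_eq_mul_inv,
      div_le_div_iff₀ (by positivity) (by positivity), one_mul]
    rcases le_total ‖y‖ 1 with h1 | h1
    · calc (1 + ‖y‖) ^ q ≤ 2 ^ q := by gcongr; linarith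
        _ ≤ 2 ^ q * (1 + ‖y‖ ^ q) := by
          have : 0 ≤ ‖y‖ ^ q := by positivity
          have : (0 : ℝ) < 2 ^ q := by positivity
          nlinarith
    · calc (1 + ‖y‖) ^ q ≤ (2 * ‖y‖) ^ q := by gcongr; linarith
        _ = 2 ^ q * ‖y‖ ^ q := Real.mul_rpow (by norm_num) (norm_nonneg _)
        _ ≤ 2 ^ q * (1 + ‖y‖ ^ q) := by gcongr; linarith

/-- The weighted `L^1` condition defining `𝓛^s`, with exponent `q = N + 2s`. -/
def DecayIntegrable {N : ℕ} (q : ℝ) (g : Eucl N → ℝ) : Prop :=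
  Integrable (fun y => g y * (1 / (1 + ‖y‖ ^ q)))

theorem MemLs.decayIntegrable {N : ℕ} {s : ℝ} {g : Eucl N → ℝ} (h : MemLs s g) :
    DecayIntegrable ((N : ℝ) + 2 * s) g := by
  refine h.2.mono (h.1.aestronglyMeasurable.mul ?_) (Eventually.of_forall fun y => ?_)
  · exact (measurable_const.div
      (measurable_const.add (measurable_norm.pow_const _))).aestronglyMeasurable
  · have : 0 < 1 + ‖y‖ ^ ((N : ℝ) + 2 * s) := by positivity
    rw [mul_one_div, norm_div, norm_div]
    simp

theorem DecayIntegrable.integrable_mul_truncKernel {N : ℕ} {q ε : ℝ} {g : Eucl N → ℝ}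
    (hg : DecayIntegrable q g) (hq : 0 ≤ q) (hε : 0 < ε) (x : Eucl N) :
    Integrable (fun y => g y * truncKernel q ε (x - y)) := by
  have hk : Measurable (fun y : Eucl N => truncKernel q ε (x - y) * (1 + ‖y‖ ^ q)) :=
    ((measurable_truncKernel q ε).comp (measurable_const.sub measurable_id)).mul
      (measurable_const.add (measurable_norm.pow_const q))
  have := hg.mul_bdd (c := 2 * ((1 + ‖x‖) / ε + 1) ^ q) hk.aestronglyMeasurable
    (Eventually.of_forall fun y => ?_)
  · refine this.congr (Eventually.of_forall fun y => ?_)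
    have : 0 < 1 + ‖y‖ ^ q := by positivity
    simp only
    field_simp
  · have h1 := truncKernel_sub_le hq hε (norm_nonneg x) le_rfl y
    have : 0 < 1 + ‖y‖ ^ q := by positivity
    rw [Real.norm_of_nonneg (mul_nonneg (truncKernel_nonneg _ _ _) this.le)]
    rwa [mul_one_div, le_div_iff₀ this] at h1

theorem decayIntegrable_const {N : ℕ} {q : ℝ} (hq : (N : ℝ) < q) (a : ℝ) :
    DecayIntegrable q (fun _ : Eucl N => a) :=
  (integrable_one_div_one_add_rpow hq).const_mul a

theorem integrable_truncKernel {N : ℕ} {q ε : ℝ} (hq : (N : ℝ) < q) (hε : 0 < ε) (x : Eucl N) :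
    Integrable (fun y => truncKernel q ε (x - y)) := by
  have hq0 : 0 ≤ q := (Nat.cast_nonneg N).trans hq.le
  simpa using (decayIntegrable_const hq 1).integrable_mul_truncKernel hq0 hε x

theorem decayIntegrable_of_bounded {N : ℕ} {q M : ℝ} (hq : (N : ℝ) < q) {g : Eucl N → ℝ}
    (hg : AEStronglyMeasurable g) (hM : ∀ x, |g x| ≤ M) : DecayIntegrable q g :=
  (integrable_one_div_one_add_rpow hq).bdd_mul hg (Eventually.of_forall hM)

theorem DecayIntegrable.integrable_sub_mul_truncKernel {N : ℕ} {q ε : ℝ} {g : Eucl N → ℝ}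
    (hg : DecayIntegrable q g) (hq : (N : ℝ) < q) (hε : 0 < ε) (x : Eucl N) (a : ℝ) :
    Integrable (fun y => (a - g y) * truncKernel q ε (x - y)) := by
  have hq0 : 0 ≤ q := (Nat.cast_nonneg N).trans hq.le
  have := ((integrable_truncKernel hq hε x).const_mul a).sub
    (hg.integrable_mul_truncKernel hq0 hε x)
  refine this.congr (Eventually.of_forall fun y => ?_)
  simp only [Pi.sub_apply]; ring

/-! ### Radial integrals of powers outside and inside a ball -/

section Radial

variable {N : ℕ}

theorem integral_truncKernel_eq (hN : 1 ≤ N) {q r : ℝ} (hq : (N : ℝ) < q) (hr : 0 < r) :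
    ∫ z : Eucl N, truncKernel q r z =
      N * volume.real (Metric.ball (0 : Eucl N) 1) / (q - N) * r ^ ((N : ℝ) - q) := by
  have : Nonempty (Fin N) := ⟨⟨0, hN⟩⟩
  have h := integral_fun_norm_addHaar (volume : Measure (Eucl N))
    (fun t => if r ≤ t then 1 / t ^ q else 0)
  have e : ∫ y in Set.Ioi (0 : ℝ), y ^ (N - 1) • (if r ≤ y then 1 / y ^ q else 0) =
      r ^ ((N : ℝ) - q) / (q - N) := by
    have e1 : ∫ y in Set.Ioi (0 : ℝ), y ^ (N - 1) • (if r ≤ y then 1 / y ^ q else 0) =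
        ∫ y in Set.Ioi (0 : ℝ), (Set.Ici r).indicator (fun y => y ^ ((N : ℝ) - 1 - q)) y := by
      refine setIntegral_congr_fun measurableSet_Ioi fun y hy => ?_
      have hy : 0 < y := hy
      by_cases h : r ≤ y
      · simp only [Set.indicator, Set.mem_Ici, h, if_true]
        rw [Real.rpow_sub hy, show (N : ℝ) - 1 = ((N - 1 : ℕ) : ℝ) by rw [Nat.cast_sub hN, Nat.cast_one],
          Real.rpow_natCast]
        simp [div_eq_mul_inv]
      · simp [h]
    rw [e1, setIntegral_indicator measurableSet_Ici, Set.inter_eq_right.2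
      (show Set.Ici r ⊆ Set.Ioi 0 from fun y hy => lt_of_lt_of_le hr hy), integral_Ici_eq_integral_Ioi,
      integral_Ioi_rpow_of_lt (by linarith) hr]
    rw [show (N : ℝ) - 1 - q + 1 = N - q by ring, show q - (N : ℝ) = -(N - q) by ring, div_neg,
      neg_div]
  simp only [finrank_euclideanSpace, Fintype.card_fin] at h
  rw [e] at h
  unfold truncKernel
  rw [h]
  simp only [nsmul_eq_mul, smul_eq_mul]
  ring

/-- The function `|z|^b` on `|z| < r`. -/
noncomputable def ballPow (b r : ℝ) (z : Eucl N) : ℝ := if ‖z‖ < r then ‖z‖ ^ b else 0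

theorem ballPow_nonneg (b r : ℝ) (z : Eucl N) : 0 ≤ ballPow b r z := by
  unfold ballPow; split_ifs <;> positivity

theorem ballPow_aux (hN : 1 ≤ N) {b r y : ℝ} (hy : 0 < y) :
    y ^ (N - 1) • (if y < r then y ^ b else 0) =
      (Set.Iio r).indicator (fun y => y ^ ((N : ℝ) - 1 + b)) y := by
  by_cases h : y < r
  · simp only [Set.indicator, Set.mem_Iio, h, if_true]
    rw [Real.rpow_add hy, show (N : ℝ) - 1 = ((N - 1 : ℕ) : ℝ) by rw [Nat.cast_sub hN, Nat.cast_one],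
          Real.rpow_natCast]
    simp
  · simp [h]

theorem integrable_ballPow (hN : 1 ≤ N) {b r : ℝ} (hb : -(N : ℝ) < b) (hr : 0 < r) :
    Integrable (ballPow b r : Eucl N → ℝ) := by
  have : Nonempty (Fin N) := ⟨⟨0, hN⟩⟩
  have h := (integrable_fun_norm_addHaar (volume : Measure (Eucl N))
    (f := fun t => if t < r then t ^ b else 0)).2
  refine h ?_
  simp only [finrank_euclideanSpace, Fintype.card_fin]
  have : IntegrableOn ((Set.Iio r).indicator (fun y => y ^ ((N : ℝ) - 1 + b)))
      (Set.Ioi (0 : ℝ)) := by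
    rw [IntegrableOn, integrable_indicator_iff measurableSet_Iio, IntegrableOn,
      Measure.restrict_restrict measurableSet_Iio, Set.inter_comm, Set.Ioi_inter_Iio]
    exact (intervalIntegral.integrableOn_Ioo_rpow_iff hr).2 (by linarith)
  exact this.congr_fun (fun y hy => (ballPow_aux hN hy).symm) measurableSet_Ioi

theorem integral_ballPow (hN : 1 ≤ N) {b r : ℝ} (hb : -(N : ℝ) < b) (hr : 0 < r) :
    ∫ z : Eucl N, ballPow b r z =
      N * volume.real (Metric.ball (0 : Eucl N) 1) / (N + b) * r ^ ((N : ℝ) + b) := by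
  have : Nonempty (Fin N) := ⟨⟨0, hN⟩⟩
  have h := integral_fun_norm_addHaar (volume : Measure (Eucl N))
    (fun t => if t < r then t ^ b else 0)
  simp only [finrank_euclideanSpace, Fintype.card_fin] at h
  unfold ballPow
  rw [h, setIntegral_congr_fun measurableSet_Ioi (fun y hy => ballPow_aux hN hy),
    setIntegral_indicator measurableSet_Iio, Set.Ioi_inter_Iio, ← integral_Ioc_eq_integral_Ioo,
    ← intervalIntegral.integral_of_le hr.le, integral_rpow (Or.inl (by linarith))]
  rw [show (N : ℝ) - 1 + b + 1 = N + b by ring, Real.zero_rpow (by linarith)]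
  simp only [nsmul_eq_mul, smul_eq_mul]
  ring

end Radial

/-- The tangent line inequality for the convex function `|t|^p` at `a`. It follows from Bernoulli's
inequality at `|b|/|a|`; at `a = 0` the convention `sign 0 = 0` makes the right side vanish. -/
theorem abs_rpow_sub_abs_rpow_le {p : ℝ} (hp : 1 ≤ p) (a b : ℝ) :
    |a| ^ p - |b| ^ p ≤ p * |a| ^ (p - 1) * SignType.sign a * (a - b) := by
  rcases eq_or_ne a 0 with rfl | ha
  · have : 0 ≤ |b| ^ p := by positivity
    simp [Real.zero_rpow (by linarith : p ≠ 0), this]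
  have hA : 0 < |a| := abs_pos.2 ha
  have h1 := one_add_mul_self_le_rpow_one_add (s := |b| / |a| - 1)
    (by have : 0 ≤ |b| / |a| := by positivity
        linarith) hp
  rw [add_sub_cancel, Real.div_rpow (abs_nonneg b) hA.le, le_div_iff₀ (by positivity)] at h1
  have h2 : |a| ^ p = |a| ^ (p - 1) * |a| := by
    rw [← Real.rpow_add_one hA.ne', sub_add_cancel]
  have h3 : |a| - |b| ≤ SignType.sign a * (a - b) := by
    rw [mul_sub, sign_mul_self]
    have : (SignType.sign a : ℝ) * b ≤ |b| := by
      rcases lt_or_gt_of_ne ha with h | h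
      · rw [sign_neg h]; simpa using neg_le_abs b
      · rw [sign_pos h]; simpa using le_abs_self b
    linarith
  have h4 : 0 ≤ p * |a| ^ (p - 1) := by positivity
  calc |a| ^ p - |b| ^ p ≤ p * |a| ^ (p - 1) * (|a| - |b|) := by
        have e : (1 + p * (|b| / |a| - 1)) * |a| ^ p
            = |a| ^ p + p * |a| ^ (p - 1) * (|b| - |a|) := by
          rw [h2]; field_simp
        rw [e] at h1
        linarith
    _ ≤ p * |a| ^ (p - 1) * (SignType.sign a * (a - b)) := by gcongr
    _ = _ := by ring

/-! ### Consequences of the local Hölder regularity -/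

section Regularity

variable {N : ℕ} {s : ℝ} {u : Eucl N → ℝ}

theorem Regular.continuous (hs : 0 < s) (h : Regular s u) : Continuous u := by
  rcases lt_or_ge s (1 / 2) with h1 | h1
  · obtain ⟨θ, hθ, -, hH⟩ := h.1 h1
    rw [continuous_iff_continuousAt]
    intro x
    obtain ⟨C, hC⟩ := hH (Metric.closedBall x 1) (isCompact_closedBall x 1)
    have hθ0 : 0 < θ := by
      have : (0 : ℝ) < θ := by linarith
      exact_mod_cast this
    exact (hC.continuousOn hθ0).continuousAt (Metric.closedBall_mem_nhds x one_pos)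
  · exact (h.2 h1).1.continuous

/-- A common form of the two regularity classes: `D = 0` for `s < 1/2` and `D` the derivative
otherwise, where the mean value inequality adds one to the Hölder exponent. The gain `σ > 2s` makes
`|z|^{σ-N-2s}` integrable at the origin. -/
theorem Regular.exists_local_expansion (hs : 0 < s) (h : Regular s u) (R : ℝ) :
    ∃ C σ : ℝ, 0 ≤ C ∧ 2 * s < σ ∧ ∀ x, ‖x‖ ≤ R → ∃ D : Eucl N →L[ℝ] ℝ,
      ∀ z, ‖z‖ ≤ 1 → |u (x + z) - u x - D z| ≤ C * ‖z‖ ^ σ := by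
  rcases lt_or_ge s (1 / 2) with h1 | h1
  · obtain ⟨θ, hθ, -, hH⟩ := h.1 h1
    obtain ⟨C, hC⟩ := hH (Metric.closedBall 0 (R + 1)) (isCompact_closedBall _ _)
    refine ⟨C, θ, C.2, hθ, fun x hx => ⟨0, fun z hz => ?_⟩⟩
    have hd := hC.dist_le (x := x + z) (y := x)
      (by simpa using (norm_add_le x z).trans (by linarith))
      (by simpa using hx.trans (by linarith))
    simpa [Real.dist_eq] using hd
  · obtain ⟨hd, θ, hθ, -, hH⟩ := h.2 h1
    obtain ⟨C, hC⟩ := hH (Metric.closedBall 0 (R + 1)) (isCompact_closedBall _ _)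
    refine ⟨C, 1 + θ, C.2, by linarith, fun x hx => ⟨fderiv ℝ u x, fun z hz => ?_⟩⟩
    have hθ0 : (0 : ℝ) ≤ θ := θ.2
    have key := (convex_closedBall x ‖z‖).norm_image_sub_le_of_norm_hasFDerivWithin_le'
      (f := u) (f' := fun y => fderiv ℝ u y) (φ := fderiv ℝ u x) (C := C * ‖z‖ ^ (θ : ℝ))
      (x := x) (y := x + z)
      (fun y _ => ((hd.differentiable one_ne_zero) y).hasFDerivAt.hasFDerivWithinAt)
      (fun y hy => by
        have hy' : ‖y - x‖ ≤ ‖z‖ := by simpa [dist_eq_norm] using hy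
        have hyn : ‖y‖ ≤ R + 1 := by
          have := norm_add_le (y - x) x
          rw [sub_add_cancel] at this
          linarith
        have := hC.dist_le (x := y) (y := x) (by simpa using hyn)
          (by simpa using hx.trans (by linarith))
        rw [dist_eq_norm, dist_eq_norm] at this
        refine this.trans ?_
        gcongr)
      (by simp) (by simp)
    rw [add_sub_cancel_left, Real.norm_eq_abs] at key
    refine key.trans_eq ?_
    rcases eq_or_ne z 0 with rfl | hz0
    · simp [Real.zero_rpow (by linarith : (1 + (θ : ℝ)) ≠ 0)]
    · rw [Real.rpow_add (norm_pos_iff.2 hz0), Real.rpow_one]; ring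

end Regularity

/-! ### Locally uniform bounds for the truncated operators -/

section Bound

variable {N : ℕ}

theorem integral_odd_eq_zero {f : Eucl N → ℝ} (hf : ∀ z, f (-z) = -f z) : ∫ z, f z = 0 := by
  have h := integral_neg_eq_self f volume
  simp only [hf, integral_neg] at h
  linarith

theorem truncFL_eq_integral (q ε : ℝ) (g : Eucl N → ℝ) (x : Eucl N) :
    truncFL q ε g x = ∫ z, (g x - g (x - z)) * truncKernel q ε z := by
  rw [truncFL, ← integral_sub_left_eq_self _ volume x]
  simp

theorem integrable_linear_ball_mul_truncKernel {q ε : ℝ} (hq : (N : ℝ) < q) (hε : 0 < ε)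
    (D : Eucl N →L[ℝ] ℝ) (r : ℝ) :
    Integrable (fun z => (if ‖z‖ < r then D z else 0) * truncKernel q ε z) := by
  have hk : Integrable (fun z : Eucl N => truncKernel q ε z) := by
    have := integrable_truncKernel hq hε (0 : Eucl N)
    simpa [truncKernel_neg] using this
  refine hk.bdd_mul (c := ‖D‖ * |r|) ?_ (Eventually.of_forall fun z => ?_)
  · exact (Measurable.ite (measurableSet_lt measurable_norm measurable_const)
      D.continuous.measurable measurable_const).aestronglyMeasurable
  · split_ifs with h
    · refine (D.le_opNorm z).trans ?_
      gcongr
      exact h.le.trans (le_abs_self r)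
    · simp; positivity

/-- The linear term of the expansion is odd and integrates to zero against the even kernel, for each
`ε`. What remains is at most `C |z|^{σ-q}` for `|z| < 1` and does not depend on `ε` for `|z| ≥ 1`.
The bound justifies dominated convergence as `ε → 0`. -/
theorem exists_bound_truncFL (hN : 1 ≤ N) {s : ℝ} (hs : 0 < s) {u : Eucl N → ℝ}
    (hreg : Regular s u) (hu : DecayIntegrable ((N : ℝ) + 2 * s) u) {R : ℝ} (hR : 0 ≤ R) :
    ∃ M : ℝ, ∀ x, ‖x‖ ≤ R → ∀ ε, 0 < ε → ε ≤ 1 → |truncFL ((N : ℝ) + 2 * s) ε u x| ≤ M := by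
  set q : ℝ := (N : ℝ) + 2 * s with hqdef
  have hq : (N : ℝ) < q := by rw [hqdef]; linarith
  have hq0 : 0 ≤ q := (Nat.cast_nonneg N).trans hq.le
  have hcont : Continuous u := hreg.continuous hs
  obtain ⟨C, σ, hC, hσ, hexp⟩ := hreg.exists_local_expansion hs R
  obtain ⟨U, hU⟩ := (isCompact_closedBall (0 : Eucl N) R).exists_bound_of_continuousOn
    hcont.continuousOn
  have habs : DecayIntegrable q (fun y => |u y|) := by
    refine hu.abs.congr (Eventually.of_forall fun y => ?_)
    have : 0 ≤ 1 / (1 + ‖y‖ ^ q) := by positivity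
    simp only [abs_mul, abs_of_nonneg this]
  have hball : Integrable (ballPow (σ - q) 1 : Eucl N → ℝ) :=
    integrable_ballPow hN (by rw [hqdef]; linarith) one_pos
  set A : ℝ := 2 * ((1 + R) / 1 + 1) ^ q
  refine ⟨C * (∫ z : Eucl N, ballPow (σ - q) 1 z) +
    ∫ y : Eucl N, (U + |u y|) * (A * (1 / (1 + ‖y‖ ^ q))), fun x hx ε hε hε1 => ?_⟩
  obtain ⟨D, hD⟩ := hexp x hx
  have hlin := integrable_linear_ball_mul_truncKernel hq hε D 1
  have hzero : ∫ z, (if ‖z‖ < 1 then D z else 0) * truncKernel q ε z = 0 := by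
    refine integral_odd_eq_zero fun z => ?_
    rw [norm_neg, truncKernel_neg, map_neg]
    split_ifs <;> ring
  have hmain : Integrable (fun z => (u x - u (x - z)) * truncKernel q ε z) := by
    have := (hu.integrable_sub_mul_truncKernel hq hε x (u x)).comp_sub_left x
    simpa using this
  have hfar : Integrable (fun z => (U + |u (x - z)|) * truncKernel q 1 z) := by
    have h1 := ((integrable_truncKernel hq one_pos x).const_mul U).add
      (habs.integrable_mul_truncKernel hq0 one_pos x)
    refine (h1.comp_sub_left x).congr (Eventually.of_forall fun z => ?_)
    simp only [Pi.add_apply, sub_sub_cancel]; ring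
  have hrw : truncFL q ε u x = ∫ z, ((u x - u (x - z)) * truncKernel q ε z -
      (if ‖z‖ < 1 then D z else 0) * truncKernel q ε z) := by
    rw [integral_sub hmain hlin, hzero, sub_zero, truncFL_eq_integral]
  have hUx : |u x| ≤ U := hU x (by simpa using hx)
  rw [hrw, ← Real.norm_eq_abs]
  calc _ ≤ ∫ z, (C * ballPow (σ - q) 1 z + (U + |u (x - z)|) * truncKernel q 1 z) := by
        refine norm_integral_le_of_norm_le ((hball.const_mul C).add hfar)
          (Eventually.of_forall fun z => ?_)
        have hk := truncKernel_nonneg q ε z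
        rw [← sub_mul, norm_mul, Real.norm_of_nonneg hk, Real.norm_eq_abs]
        by_cases hz : ‖z‖ < 1
        · have h0 : truncKernel q 1 z = 0 := by rw [truncKernel, if_neg (not_le.2 hz)]
          have hb : ballPow (σ - q) 1 z = ‖z‖ ^ (σ - q) := by rw [ballPow, if_pos hz]
          rw [if_pos hz, h0, mul_zero, add_zero, hb]
          by_cases hez : ε ≤ ‖z‖
          · have hzp : 0 < ‖z‖ := hε.trans_le hez
            rw [truncKernel, if_pos hez, Real.rpow_sub hzp, ← mul_div_assoc, mul_one, ← mul_div_assoc]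
            refine div_le_div_of_nonneg_right ?_ (Real.rpow_nonneg hzp.le q)
            have h2 := hD (-z) (by simpa using hz.le)
            rw [norm_neg, map_neg, ← abs_neg] at h2
            rwa [show u x - u (x - z) - D z = -(u (x + -z) - u x - -D z) by
              rw [sub_eq_add_neg x z]; ring]
          · rw [truncKernel, if_neg hez, mul_zero]; positivity
        · have hb : ballPow (σ - q) 1 z = 0 := by rw [ballPow, if_neg hz]
          have hz1 : 1 ≤ ‖z‖ := not_lt.1 hz
          have h0 : truncKernel q ε z = truncKernel q 1 z := by
            rw [truncKernel, if_pos (hε1.trans hz1), truncKernel, if_pos hz1]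
          rw [if_neg hz, sub_zero, hb, h0, mul_zero, zero_add]
          rw [h0] at hk
          gcongr
          exact (abs_sub _ _).trans (by linarith)
    _ = C * (∫ z : Eucl N, ballPow (σ - q) 1 z) + ∫ z, (U + |u (x - z)|) * truncKernel q 1 z := by
        rw [integral_add (hball.const_mul C) hfar, integral_const_mul]
    _ ≤ _ := by
        refine add_le_add_right ?_ _
        rw [← integral_sub_left_eq_self _ volume x]
        have hfar' := hfar.comp_sub_left x
        simp only [sub_sub_cancel] at hfar' ⊢
        refine integral_mono hfar' ?_ fun y => ?_
        · have := ((decayIntegrable_const hq U).add habs).const_mul A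
          refine this.congr (Eventually.of_forall fun y => ?_)
          simp only [Pi.add_apply]; ring
        · have h1 := truncKernel_sub_le hq0 one_pos hR hx y
          have hU0 : 0 ≤ U := (abs_nonneg _).trans hUx
          simp only
          gcongr

end Bound

/-! ### Symmetry and the tested inequality -/

variable {N : ℕ}

theorem integrable_of_bounded_of_support {φ : Eucl N → ℝ} (hφ : Measurable φ) {M R : ℝ}
    (hM : ∀ x, ‖x‖ ≤ R → |φ x| ≤ M) (hR : ∀ x, R < ‖x‖ → φ x = 0) : Integrable φ := by
  have h : IntegrableOn φ (Metric.closedBall 0 R) := by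
    refine Measure.integrableOn_of_bounded (M := M) measure_closedBall_lt_top.ne
      hφ.aestronglyMeasurable ?_
    exact (ae_restrict_iff' Metric.isClosed_closedBall.measurableSet).2
      (Eventually.of_forall fun x hx => hM x (by simpa using hx))
  refine (integrableOn_iff_integrable_of_support_subset fun x hx => ?_).1 h
  rw [mem_closedBall_zero_iff]
  by_contra hlt
  exact hx (hR x (not_le.1 hlt))

theorem measurable_truncKernel_sub (q ε : ℝ) :
    Measurable (fun z : Eucl N × Eucl N => truncKernel q ε (z.1 - z.2)) :=
  (measurable_truncKernel q ε).comp (measurable_fst.sub measurable_snd)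

theorem measurable_truncFL (q ε : ℝ) {g : Eucl N → ℝ} (hg : Measurable g) :
    Measurable (truncFL q ε g) := by
  have h : Measurable (fun z : Eucl N × Eucl N => (g z.1 - g z.2) * truncKernel q ε (z.1 - z.2)) :=
    ((hg.comp measurable_fst).sub (hg.comp measurable_snd)).mul (measurable_truncKernel_sub q ε)
  exact h.stronglyMeasurable.integral_prod_right.measurable

/-- The truncated fractional Laplacian is symmetric. -/
theorem truncFL_symmetric {q ε M R : ℝ} (hq : (N : ℝ) < q) (hε : 0 < ε) (hR0 : 0 ≤ R)
    {v φ : Eucl N → ℝ} (hvc : Continuous v) (hv : DecayIntegrable q v)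
    (hφ : Measurable φ) (hM : ∀ x, |φ x| ≤ M) (hR : ∀ x, R < ‖x‖ → φ x = 0) :
    Integrable (fun x => φ x * truncFL q ε v x) ∧ Integrable (fun x => v x * truncFL q ε φ x) ∧
      ∫ x, φ x * truncFL q ε v x = ∫ x, v x * truncFL q ε φ x := by
  have hq0 : 0 ≤ q := (Nat.cast_nonneg N).trans hq.le
  have hM0 : 0 ≤ M := (abs_nonneg _).trans (hM 0)
  have hφi : Integrable φ := integrable_of_bounded_of_support hφ (fun x _ => hM x) hR
  obtain ⟨V, hV⟩ := (isCompact_closedBall (0 : Eucl N) R).exists_bound_of_continuousOn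
    hvc.continuousOn
  have hφv : Integrable (fun x => φ x * v x) := by
    refine integrable_of_bounded_of_support (hφ.mul hvc.measurable) (M := M * V) (R := R)
      (fun x hx => ?_) fun x hx => by rw [hR x hx, zero_mul]
    rw [abs_mul]
    exact mul_le_mul (hM x) (hV x (by simpa using hx)) (abs_nonneg _) hM0
  set A : ℝ := 2 * ((1 + R) / ε + 1) ^ q with hA
  have hA0 : 0 ≤ A := by positivity
  -- The cross term of both pairings. Since the kernel has finite mass `κ`, the diagonal term `κ φ
  -- v` splits off and is the same on both sides, so symmetry reduces to Fubini for `F`.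
  set F : Eucl N × Eucl N → ℝ := fun z => φ z.1 * v z.2 * truncKernel q ε (z.1 - z.2) with hF
  have hFi : Integrable F (volume.prod volume) := by
    refine ((hφi.const_mul A).mul_prod hv).mono ?_ (Eventually.of_forall fun z => ?_)
    · exact (((hφ.comp measurable_fst).mul (hvc.measurable.comp measurable_snd)).mul
        (measurable_truncKernel_sub q ε)).aestronglyMeasurable
    · by_cases hz : ‖z.1‖ ≤ R
      · have h1 := truncKernel_sub_le hq0 hε hR0 hz z.2
        have h2 := truncKernel_nonneg q ε (z.1 - z.2)
        have h3 : 0 ≤ 1 / (1 + ‖z.2‖ ^ q) := by positivity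
        simp only [hF, norm_mul, Real.norm_eq_abs, abs_of_nonneg h2, abs_of_nonneg h3,
          abs_of_nonneg hA0]
        calc |φ z.1| * |v z.2| * truncKernel q ε (z.1 - z.2)
            ≤ |φ z.1| * |v z.2| * (A * (1 / (1 + ‖z.2‖ ^ q))) := by gcongr
          _ = _ := by ring
      · simp [hF, hR z.1 (not_le.1 hz)]
  have hFs : Integrable (fun z => F z.swap) (volume.prod volume) := hFi.swap
  have hκ : ∀ x : Eucl N, ∫ y, truncKernel q ε (x - y) = ∫ y : Eucl N, truncKernel q ε y :=
    fun x => integral_sub_left_eq_self (truncKernel q ε) volume x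
  set κ : ℝ := ∫ y : Eucl N, truncKernel q ε y
  have hφd : DecayIntegrable q φ := decayIntegrable_of_bounded hq hφ.aestronglyMeasurable hM
  have e1 : ∀ x, φ x * truncFL q ε v x = φ x * v x * κ - ∫ y, F (x, y) := by
    intro x
    rw [truncFL, ← integral_const_mul, ← hκ x, ← integral_const_mul, ← integral_sub]
    · congr 1; ext y; simp only [hF]; ring
    · exact (integrable_truncKernel hq hε x).const_mul _
    · refine ((hv.integrable_mul_truncKernel hq0 hε x).const_mul (φ x)).congr
        (Eventually.of_forall fun y => ?_)
      simp only [hF]; ring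
  have e2 : ∀ x, v x * truncFL q ε φ x = φ x * v x * κ - ∫ y, F (y, x) := by
    intro x
    rw [truncFL, ← integral_const_mul, ← hκ x, ← integral_const_mul, ← integral_sub]
    · congr 1; ext y; simp only [hF]; rw [truncKernel_sub_comm q ε y x]; ring
    · exact (integrable_truncKernel hq hε x).const_mul _
    · refine ((hφd.integrable_mul_truncKernel hq0 hε x).const_mul (v x)).congr
        (Eventually.of_forall fun y => ?_)
      simp only [hF]; rw [truncKernel_sub_comm q ε y x]; ring
  have i1 : Integrable (fun x => ∫ y, F (x, y)) := hFi.integral_prod_left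
  have i2 : Integrable (fun x => ∫ y, F (y, x)) := hFs.integral_prod_left
  have e3 : ∫ x, ∫ y, F (x, y) = ∫ x, ∫ y, F (y, x) := integral_integral_swap hFi
  simp only [e1, e2]
  refine ⟨(hφv.mul_const κ).sub i1, (hφv.mul_const κ).sub i2, ?_⟩
  rw [integral_sub (hφv.mul_const κ) i1, integral_sub (hφv.mul_const κ) i2, e3]

theorem fracConst_pos (N : ℕ) {s : ℝ} (hs₀ : 0 < s) (hs₁ : s < 1) : 0 < fracConst N s := by
  unfold fracConst
  have h1 : 0 < Real.Gamma (((N : ℝ) + 2 * s) / 2) := Real.Gamma_pos_of_pos (by positivity)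
  have h2 : 0 < Real.Gamma (1 - s) := Real.Gamma_pos_of_pos (by linarith)
  positivity

/-- The convexity inequality for `|u|^p`, integrated against the truncated kernel. -/
theorem truncFL_abs_rpow_le {q ε p : ℝ} (hq : (N : ℝ) < q) (hε : 0 < ε) (hp : 1 ≤ p)
    {u : Eucl N → ℝ} (hu : DecayIntegrable q u) (hv : DecayIntegrable q (fun x => |u x| ^ p))
    (x : Eucl N) :
    truncFL q ε (fun x => |u x| ^ p) x ≤
      p * |u x| ^ (p - 1) * SignType.sign (u x) * truncFL q ε u x := by
  rw [truncFL, truncFL, ← integral_const_mul]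
  refine integral_mono (hv.integrable_sub_mul_truncKernel hq hε x _)
    ((hu.integrable_sub_mul_truncKernel hq hε x _).const_mul _) fun y => ?_
  have := mul_le_mul_of_nonneg_right (abs_rpow_sub_abs_rpow_le hp (u x) (u y))
    (truncKernel_nonneg q ε (x - y))
  simp only
  linarith

/-- Testing the equation against a bounded compactly supported function `φ ≥ 0` whose truncated
fractional Laplacians are bounded below by `-b`. -/
theorem IsSolution.integral_test_le (hN : 1 ≤ N) {s p : ℝ} (hs₀ : 0 < s) (hs₁ : s < 1) (hp : 1 ≤ p)
    {ρ c u : Eucl N → ℝ} (hsol : IsSolution s ρ c u) (hv : MemLs s (fun x => |u x| ^ p))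
    {φ b : Eucl N → ℝ} {M R : ℝ} (hR0 : 0 ≤ R) (hφ : Measurable φ) (hφ0 : ∀ x, 0 ≤ φ x)
    (hM : ∀ x, φ x ≤ M) (hR : ∀ x, R < ‖x‖ → φ x = 0)
    (hb : ∀ ε, 0 < ε → ∀ x, -truncFL ((N : ℝ) + 2 * s) ε φ x ≤ b x)
    (hvb : Integrable (fun x => |u x| ^ p * b x)) :
    p * ∫ x, φ x * (ρ x * c x * |u x| ^ p) ≤ fracConst N s * ∫ x, |u x| ^ p * b x := by
  set q : ℝ := (N : ℝ) + 2 * s with hqdef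
  have hq : (N : ℝ) < q := by rw [hqdef]; linarith
  have hucont : Continuous u := hsol.regular.continuous hs₀
  have hu : DecayIntegrable q u := hsol.memLs.decayIntegrable
  have hv' : DecayIntegrable q (fun x => |u x| ^ p) := hv.decayIntegrable
  have hvcont : Continuous (fun x => |u x| ^ p) :=
    hucont.abs.rpow_const fun x => Or.inr (by linarith)
  have hMabs : ∀ x, |φ x| ≤ M := fun x => by rw [abs_of_nonneg (hφ0 x)]; exact hM x
  have hφi : Integrable φ := integrable_of_bounded_of_support hφ (fun x _ => hMabs x) hR
  have hC := fracConst_pos N hs₀ hs₁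
  choose L hL hLeq using hsol.equation
  obtain ⟨T, hT⟩ := exists_bound_truncFL hN hs₀ hsol.regular hu hR0
  have hpc : Continuous (fun x => |u x| ^ (p - 1)) :=
    hucont.abs.rpow_const fun x => Or.inr (by linarith)
  obtain ⟨U, hU⟩ := (isCompact_closedBall (0 : Eucl N) R).exists_bound_of_continuousOn
    hpc.continuousOn
  -- Truncation radii `1/(n+1)` are at most `1`, as the uniform bound `T` requires.
  have hpoint : ∀ x, Tendsto (fun n : ℕ => truncFL q (1 / ((n : ℝ) + 1)) u x) atTop
      (𝓝 (L x / fracConst N s)) := by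
    intro x
    have h1 : Tendsto (fun ε => truncFL q ε u x) (𝓝[>] 0) (𝓝 (L x / fracConst N s)) := by
      refine ((hL x).div_const (fracConst N s)).congr fun ε => ?_
      rw [setIntegral_eq_truncFL, mul_div_cancel_left₀ _ hC.ne']
    refine h1.comp (tendsto_nhdsWithin_iff.2 ⟨tendsto_one_div_add_atTop_nhds_zero_nat,
      Eventually.of_forall fun n => ?_⟩)
    exact Nat.one_div_pos_of_nat (α := ℝ)
  set G : ℕ → Eucl N → ℝ := fun n x => φ x * (p * |u x| ^ (p - 1) * SignType.sign (u x) *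
      truncFL q (1 / ((n : ℝ) + 1)) u x) with hG
  have hGm : ∀ n, AEStronglyMeasurable (G n) := by
    intro n
    have hsgn : Measurable (fun x => ((SignType.sign (u x) : SignType) : ℝ)) := by
      have : Measurable (fun t : ℝ => ((SignType.sign t : SignType) : ℝ)) := by
        have e : (fun t : ℝ => ((SignType.sign t : SignType) : ℝ)) =
            fun t => if 0 < t then 1 else if t < 0 then -1 else 0 := by
          ext t
          rcases lt_trichotomy t 0 with h | h | h
          · rw [sign_neg h, if_neg (not_lt.2 h.le), if_pos h]; simp
          · simp [h]
          · rw [sign_pos h, if_pos h]; simp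
        rw [e]
        exact Measurable.ite measurableSet_Ioi measurable_const
          (Measurable.ite measurableSet_Iio measurable_const measurable_const)
      exact this.comp hucont.measurable
    exact (hφ.mul (((measurable_const.mul hpc.measurable).mul hsgn).mul
      (measurable_truncFL q _ hucont.measurable))).aestronglyMeasurable
  have hGb : ∀ n x, ‖G n x‖ ≤ φ x * (p * U * T) := by
    intro n x
    by_cases hx : ‖x‖ ≤ R
    · have h1 : |u x| ^ (p - 1) ≤ U := (le_abs_self _).trans (hU x (by simpa using hx))
      have h2 := hT x hx (1 / ((n : ℝ) + 1)) Nat.one_div_pos_of_nat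
        (by rw [div_le_one (by positivity)]; linarith [Nat.cast_nonneg (α := ℝ) n])
      have h3 : |((SignType.sign (u x) : SignType) : ℝ)| ≤ 1 := by
        rcases lt_trichotomy (u x) 0 with h | h | h
        · simp [sign_neg h]
        · simp [h]
        · simp [sign_pos h]
      have h4 : 0 ≤ |u x| ^ (p - 1) := by positivity
      have h5 : 0 ≤ p := by linarith
      simp only [hG, Real.norm_eq_abs, abs_mul, abs_of_nonneg (hφ0 x), abs_of_nonneg h4,
        abs_of_nonneg h5]
      have h6 := hφ0 x
      refine mul_le_mul_of_nonneg_left ?_ h6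
      refine mul_le_mul ?_ h2 (abs_nonneg _) (by have := h4.trans h1; positivity)
      calc p * |u x| ^ (p - 1) * |((SignType.sign (u x) : SignType) : ℝ)|
          ≤ p * |u x| ^ (p - 1) * 1 := by gcongr
        _ ≤ p * U := by rw [mul_one]; gcongr
    · simp [hG, hR x (not_le.1 hx)]
  have hlim := tendsto_integral_of_dominated_convergence (μ := (volume : Measure (Eucl N)))
    (F := G)
    (f := fun x => φ x * (p * |u x| ^ (p - 1) * SignType.sign (u x) * (L x / fracConst N s)))
    (fun x => φ x * (p * U * T)) hGm (hφi.mul_const _) (fun n => Eventually.of_forall (hGb n))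
    (Eventually.of_forall fun x => ((hpoint x).const_mul _).const_mul _)
  -- At each fixed truncation: the lower bound on the operator applied to `φ`, then symmetry to move
  -- it onto `|u|^p`, then convexity to pass to `u`.
  have hle : ∀ n : ℕ, -∫ x, |u x| ^ p * b x ≤ ∫ x, G n x := by
    intro n
    have hε : (0 : ℝ) < 1 / ((n : ℝ) + 1) := Nat.one_div_pos_of_nat
    obtain ⟨i1, i2, e⟩ := truncFL_symmetric hq hε hR0 hvcont hv' hφ hMabs hR
    calc -∫ x, |u x| ^ p * b x = ∫ x, -(|u x| ^ p * b x) := (integral_neg _).symm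
      _ ≤ ∫ x, |u x| ^ p * truncFL q (1 / ((n : ℝ) + 1)) φ x := by
        refine integral_mono hvb.neg i2 fun x => ?_
        have := mul_le_mul_of_nonneg_left (hb _ hε x) (by positivity : 0 ≤ |u x| ^ p)
        simp only
        linarith
      _ = ∫ x, φ x * truncFL q (1 / ((n : ℝ) + 1)) (fun x => |u x| ^ p) x := e.symm
      _ ≤ ∫ x, G n x := by
        refine integral_mono i1 ((hφi.mul_const (p * U * T)).mono' (hGm n)
          (Eventually.of_forall (hGb n))) fun x => ?_
        exact mul_le_mul_of_nonneg_left (truncFL_abs_rpow_le hq hε hp hu hv' x) (hφ0 x)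
  have hfin := ge_of_tendsto' hlim hle
  -- The limit is evaluated by the equation, using `|u|^p = |u|^{p-1} sign(u) u`.
  have hval : ∀ x, φ x * (p * |u x| ^ (p - 1) * SignType.sign (u x) * (L x / fracConst N s)) =
      -(p / fracConst N s) * (φ x * (ρ x * c x * |u x| ^ p)) := by
    intro x
    have h1 : |u x| ^ p = |u x| ^ (p - 1) * (SignType.sign (u x) * u x) := by
      rw [sign_mul_self]
      rcases eq_or_ne (u x) 0 with h | h
      · simp [h, Real.zero_rpow (by linarith : p ≠ 0)]
      · rw [← Real.rpow_add_one (abs_pos.2 h).ne', sub_add_cancel]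
    rw [h1, show L x = -(ρ x * c x * u x) by linarith [hLeq x]]
    field_simp
  simp only [hval, integral_const_mul] at hfin
  rw [neg_mul, neg_le_neg_iff, div_mul_eq_mul_div, div_le_iff₀ hC] at hfin
  linarith

/-! ### Second differences of the cut-off power, uniformly in the cutoff radius -/

/-- A smooth nonincreasing cutoff, equal to `1` on `t ≤ 1/4` and to `0` on `t ≥ 1`. -/
noncomputable def cutoff (t : ℝ) : ℝ := Real.smoothTransition (4 / 3 * (1 - t))

theorem cutoff_nonneg (t : ℝ) : 0 ≤ cutoff t := Real.smoothTransition.nonneg _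

theorem cutoff_le_one (t : ℝ) : cutoff t ≤ 1 := Real.smoothTransition.le_one _

theorem cutoff_of_le {t : ℝ} (h : t ≤ 1 / 4) : cutoff t = 1 :=
  Real.smoothTransition.one_of_one_le (by linarith)

theorem cutoff_of_ge {t : ℝ} (h : 1 ≤ t) : cutoff t = 0 :=
  Real.smoothTransition.zero_of_nonpos (by linarith)

theorem cutoff_antitone : Antitone cutoff := fun a b h =>
  Real.smoothTransition.monotone (by linarith)

theorem contDiff_cutoff : ContDiff ℝ 2 cutoff :=
  (Real.smoothTransition.contDiff (n := 2)).comp (by fun_prop)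

/-- The radial profile `t^{-β/2}`, cut off at `t = λ`. -/
noncomputable def profile (β l t : ℝ) : ℝ := t ^ (-β / 2) * cutoff (t / l)

theorem profile_antitoneOn {β l : ℝ} (hβ : 0 < β) (hl : 0 < l) :
    AntitoneOn (profile β l) (Set.Ioi 0) := by
  intro a ha b hb hab
  have ha : 0 < a := ha
  have hb : 0 < b := hb
  unfold profile
  refine mul_le_mul ?_ (cutoff_antitone (by gcongr)) (cutoff_nonneg _) (by positivity)
  exact Real.rpow_le_rpow_of_nonpos ha hab (by linarith)

theorem contDiffOn_profile (β : ℝ) : ContDiffOn ℝ 2 (profile β 1) (Set.Ioi 0) := by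
  refine ContDiffOn.mul (fun t ht => ?_)
    (contDiff_cutoff.comp (by fun_prop : ContDiff ℝ 2 fun t : ℝ => t / 1)).contDiffOn
  exact (Real.contDiffAt_rpow_const_of_ne (ne_of_gt ht)).contDiffWithinAt

/-- A pure power below `1/4`, zero above `1`, and a compactness argument between, where `t ≤ 1`
gives `t^{-β/2-2} ≥ 1`. -/
theorem exists_bound_deriv2_profile {β : ℝ} (hβ : 0 < β) :
    ∃ C : ℝ, 0 ≤ C ∧ ∀ t, 0 < t → deriv (deriv (profile β 1)) t ≤ C * t ^ (-β / 2 - 2) := by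
  have hd1 : ContDiffOn ℝ 1 (deriv (profile β 1)) (Set.Ioi 0) :=
    (contDiffOn_profile β).deriv_of_isOpen isOpen_Ioi (by norm_num)
  have hd2 : ContinuousOn (deriv (deriv (profile β 1))) (Set.Ioi 0) :=
    hd1.continuousOn_deriv_of_isOpen isOpen_Ioi le_rfl
  obtain ⟨C, hC⟩ := (isCompact_Icc (a := (1 / 4 : ℝ)) (b := 1)).exists_bound_of_continuousOn
    (hd2.mono fun t ht => lt_of_lt_of_le (by norm_num) ht.1)
  have hC0 : 0 ≤ C := (norm_nonneg _).trans (hC 1 (by norm_num))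
  refine ⟨max (-β / 2 * (-β / 2 - 1)) C, le_max_of_le_right hC0, fun t ht => ?_⟩
  have hpos : 0 < t ^ (-β / 2 - 2) := Real.rpow_pos_of_pos ht _
  rcases lt_or_ge t (1 / 4) with h1 | h1
  · have heq : profile β 1 =ᶠ[𝓝 t] fun t => t ^ (-β / 2) := by
      filter_upwards [Iio_mem_nhds h1] with y hy
      rw [profile, cutoff_of_le (by rw [div_one]; exact le_of_lt hy), mul_one]
    have h2 : deriv (deriv (profile β 1)) t = -β / 2 * (-β / 2 - 1) * t ^ (-β / 2 - 2) := by
      rw [heq.deriv.deriv_eq]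
      have := Real.iter_deriv_rpow_const (-β / 2) t 2
      simp only [Function.iterate_succ, Function.iterate_zero, Function.comp_apply, id] at this
      rw [this]
      simp [descPochhammer_succ_right]
    rw [h2]
    gcongr
    exact le_max_left _ _
  rcases le_or_gt t 1 with h2 | h2
  · calc deriv (deriv (profile β 1)) t ≤ C := (le_abs_self _).trans (hC t ⟨h1, h2⟩)
      _ = C * 1 := (mul_one C).symm
      _ ≤ max (-β / 2 * (-β / 2 - 1)) C * t ^ (-β / 2 - 2) := by
        refine mul_le_mul (le_max_right _ _) ?_ zero_le_one (le_max_of_le_right hC0)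
        exact Real.one_le_rpow_of_pos_of_le_one_of_nonpos ht h2 (by linarith)
  · have heq : profile β 1 =ᶠ[𝓝 t] fun _ => 0 := by
      filter_upwards [Ioi_mem_nhds h2] with y hy
      rw [profile, cutoff_of_ge (by simpa using (le_of_lt hy)), mul_zero]
    rw [heq.deriv.deriv_eq]
    simp
    positivity

theorem profile_eq_scaled {β l t : ℝ} (hl : 0 < l) (ht : 0 < t) :
    profile β l t = l ^ (-β / 2) * profile β 1 (t / l) := by
  rw [profile, profile, div_one, ← mul_assoc, ← Real.mul_rpow hl.le (by positivity),
    mul_div_cancel₀ _ hl.ne']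

/-- A one-sided second difference bound from an upper bound for the second derivative. -/
theorem second_diff_le {f : ℝ → ℝ} {m M : ℝ} (hm : 0 < m) (hf : ContDiffOn ℝ 2 f (Set.Ioi 0))
    (hM : ∀ t, m < t → deriv (deriv f) t ≤ M) {a h : ℝ} (h1 : m ≤ a - h) (h2 : m ≤ a + h) :
    f (a + h) + f (a - h) - 2 * f a ≤ M * h ^ 2 := by
  have hd1 : ContDiffOn ℝ 1 (deriv f) (Set.Ioi 0) :=
    hf.deriv_of_isOpen isOpen_Ioi (by norm_num)
  have hint : interior (Set.Ici m) = Set.Ioi m := interior_Ici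
  have hc : ConcaveOn ℝ (Set.Ici m) (fun t => f t - M / 2 * t ^ 2) := by
    refine concaveOn_of_hasDerivWithinAt2_nonpos (convex_Ici m)
      (f' := fun t => deriv f t - M * t) (f'' := fun t => deriv (deriv f) t - M) ?_ ?_ ?_ ?_
    · exact (hf.continuousOn.mono fun t ht => lt_of_lt_of_le hm ht).sub (by fun_prop)
    · intro t ht
      rw [hint] at ht ⊢
      have ht0 : 0 < t := hm.trans ht
      have e1 : HasDerivAt f (deriv f t) t :=
        ((hf.differentiableOn (by norm_num)).differentiableAt (Ioi_mem_nhds ht0)).hasDerivAt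
      have e2 : HasDerivAt (fun t : ℝ => M / 2 * t ^ 2) (M * t) t := by
        have := ((hasDerivAt_id t).pow 2).const_mul (M / 2)
        refine this.congr_deriv ?_
        simp; ring
      exact (e1.sub e2).hasDerivWithinAt
    · intro t ht
      rw [hint] at ht ⊢
      have ht0 : 0 < t := hm.trans ht
      have e1 : HasDerivAt (deriv f) (deriv (deriv f) t) t :=
        ((hd1.differentiableOn (by norm_num)).differentiableAt (Ioi_mem_nhds ht0)).hasDerivAt
      have e2 : HasDerivAt (fun t : ℝ => M * t) M t := by
        simpa using (hasDerivAt_id t).const_mul M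
      exact (e1.sub e2).hasDerivWithinAt
    · intro t ht
      rw [hint] at ht
      linarith [hM t ht]
  have := hc.2 (show a + h ∈ Set.Ici m from h2) (show a - h ∈ Set.Ici m from h1)
    (by norm_num : (0 : ℝ) ≤ 1 / 2) (by norm_num : (0 : ℝ) ≤ 1 / 2) (by norm_num)
  simp only [smul_eq_mul] at this
  rw [show 1 / 2 * (a + h) + 1 / 2 * (a - h) = a by ring] at this
  nlinarith

/-- Scaling reduces to `l = 1`: the powers of `l` cancel exactly, so `C` does not depend on the
cutoff. -/
theorem exists_bound_second_diff_profile {β : ℝ} (hβ : 0 < β) :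
    ∃ C : ℝ, 0 ≤ C ∧ ∀ l m a h, 0 < l → 0 < m → m ≤ a - h → m ≤ a + h →
      profile β l (a + h) + profile β l (a - h) - 2 * profile β l a ≤
        C * m ^ (-β / 2 - 2) * h ^ 2 := by
  obtain ⟨C, hC0, hC⟩ := exists_bound_deriv2_profile hβ
  refine ⟨C, hC0, fun l m a h hl hm h1 h2 => ?_⟩
  have hml : 0 < m / l := by positivity
  have key := second_diff_le (M := C * (m / l) ^ (-β / 2 - 2)) hml (contDiffOn_profile β)
    (fun t ht => (hC t (hml.trans ht)).trans (by
      gcongr ?_ * ?_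
      exact Real.rpow_le_rpow_of_nonpos hml ht.le (by linarith)))
    (a := a / l) (h := h / l) (by rw [← sub_div]; gcongr) (by rw [← add_div]; gcongr)
  rw [profile_eq_scaled hl (by linarith : 0 < a + h), profile_eq_scaled hl (by linarith : 0 < a - h),
    profile_eq_scaled hl (by linarith : 0 < a), add_div, sub_div]
  have hlp : 0 < l ^ (-β / 2) := Real.rpow_pos_of_pos hl _
  calc _ = l ^ (-β / 2) * (profile β 1 (a / l + h / l) + profile β 1 (a / l - h / l) -
        2 * profile β 1 (a / l)) := by ring
    _ ≤ l ^ (-β / 2) * (C * (m / l) ^ (-β / 2 - 2) * (h / l) ^ 2) := by gcongr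
    _ = C * m ^ (-β / 2 - 2) * h ^ 2 := by
      rw [Real.div_rpow hm.le hl.le, Real.rpow_sub hl, Real.rpow_two]
      field_simp

section TestFunction

variable {N : ℕ}

/-- The smooth part `|x|^{-β}`, cut off at `|x| = R`, of the test function. -/
noncomputable def tail (β R : ℝ) (x : Eucl N) : ℝ := ‖x‖ ^ (-β) * cutoff (‖x‖ ^ 2 / R ^ 2)

theorem tail_eq_profile (β R : ℝ) (x : Eucl N) : tail β R x = profile β (R ^ 2) (‖x‖ ^ 2) := by
  rw [tail, profile, ← Real.rpow_natCast, ← Real.rpow_natCast, ← Real.rpow_mul (norm_nonneg x)]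
  congr 2
  push_cast
  ring

/-- In the variable `t = |x|²` the points `x ± z` become `a ± h` with `a = |x|² + |z|²` and `h =
2⟨x, z⟩`. As the profile decreases, its value at `a` is at most that at `|x|²`, so the
one-dimensional bound suffices. -/
theorem exists_bound_second_diff_tail {β : ℝ} (hβ : 0 < β) :
    ∃ C : ℝ, 0 ≤ C ∧ ∀ R, 0 < R → ∀ x z : Eucl N, x ≠ 0 → ‖z‖ ≤ ‖x‖ / 2 →
      tail β R (x + z) + tail β R (x - z) - 2 * tail β R x ≤ C * ‖x‖ ^ (-β - 2) * ‖z‖ ^ 2 := by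
  obtain ⟨C, hC0, hC⟩ := exists_bound_second_diff_profile hβ
  -- The factor `1/4` comes from `|x ± z| ≥ |x|/2`, and `4` from Cauchy–Schwarz applied to `(2⟨x,
  -- z⟩)²`.
  refine ⟨C * (1 / 4) ^ (-β / 2 - 2) * 4, by positivity, fun R hR x z hx hz => ?_⟩
  have hxp : 0 < ‖x‖ := norm_pos_iff.2 hx
  have e1 : ‖x + z‖ ^ 2 = (‖x‖ ^ 2 + ‖z‖ ^ 2) + 2 * inner ℝ x z := by
    rw [norm_add_sq_real]; ring
  have e2 : ‖x - z‖ ^ 2 = (‖x‖ ^ 2 + ‖z‖ ^ 2) - 2 * inner ℝ x z := by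
    rw [norm_sub_sq_real]; ring
  have l1 : ‖x‖ / 2 ≤ ‖x + z‖ := by
    have := norm_sub_le (x + z) z
    rw [add_sub_cancel_right] at this
    linarith
  have l2 : ‖x‖ / 2 ≤ ‖x - z‖ := by
    have := norm_add_le (x - z) z
    rw [sub_add_cancel] at this
    linarith
  have b1 : 1 / 4 * ‖x‖ ^ 2 ≤ ‖x + z‖ ^ 2 := by nlinarith [norm_nonneg (x + z)]
  have b2 : 1 / 4 * ‖x‖ ^ 2 ≤ ‖x - z‖ ^ 2 := by nlinarith [norm_nonneg (x - z)]
  have key := hC (R ^ 2) (1 / 4 * ‖x‖ ^ 2) (‖x‖ ^ 2 + ‖z‖ ^ 2) (2 * inner ℝ x z) (by positivity)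
    (by positivity) (by rwa [← e2]) (by rwa [← e1])
  have mono := profile_antitoneOn hβ (by positivity : 0 < R ^ 2)
    (show ‖x‖ ^ 2 ∈ Set.Ioi 0 by simp; positivity)
    (show ‖x‖ ^ 2 + ‖z‖ ^ 2 ∈ Set.Ioi 0 by simp; positivity) (by linarith [sq_nonneg ‖z‖])
  have hin : (2 * inner ℝ x z) ^ 2 ≤ 4 * (‖x‖ ^ 2 * ‖z‖ ^ 2) := by
    have := abs_real_inner_le_norm x z
    have h2 := pow_le_pow_left₀ (abs_nonneg _) this 2
    rw [sq_abs, mul_pow] at h2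
    linarith
  rw [tail_eq_profile, tail_eq_profile, tail_eq_profile, e1, e2]
  calc _ ≤ C * (1 / 4 * ‖x‖ ^ 2) ^ (-β / 2 - 2) * (2 * inner ℝ x z) ^ 2 := by linarith
    _ ≤ C * (1 / 4 * ‖x‖ ^ 2) ^ (-β / 2 - 2) * (4 * (‖x‖ ^ 2 * ‖z‖ ^ 2)) := by gcongr
    _ = _ := by
      rw [Real.mul_rpow (by norm_num) (by positivity)]
      have : (‖x‖ ^ 2) ^ (-β / 2 - 2) * ‖x‖ ^ 2 = ‖x‖ ^ (-β - 2) := by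
        rw [← Real.rpow_natCast, ← Real.rpow_mul (norm_nonneg x), ← Real.rpow_add hxp]
        congr 1
        push_cast
        ring
      rw [← this]
      ring

end TestFunction

/-! ### The barrier and the test functions -/

/-- The barrier `min(1, |x|^{-β})`. -/
noncomputable def barrier (β : ℝ) (x : Eucl N) : ℝ := if ‖x‖ ≤ 1 then 1 else ‖x‖ ^ (-β)

/-- The barrier, cut off at `|x| = R`. -/
noncomputable def testFun (β R : ℝ) (x : Eucl N) : ℝ := if ‖x‖ ≤ 1 then 1 else tail β R x

theorem tail_nonneg (β R : ℝ) (x : Eucl N) : 0 ≤ tail β R x :=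
  mul_nonneg (by positivity) (cutoff_nonneg _)

theorem measurable_tail (β R : ℝ) : Measurable (tail β R : Eucl N → ℝ) :=
  (measurable_norm.pow_const _).mul
    (contDiff_cutoff.continuous.measurable.comp ((measurable_norm.pow_const 2).div_const _))

theorem measurable_testFun (β R : ℝ) : Measurable (testFun β R : Eucl N → ℝ) :=
  Measurable.ite (measurableSet_le measurable_norm measurable_const) measurable_const
    (measurable_tail β R)

theorem measurable_barrier (β : ℝ) : Measurable (barrier β : Eucl N → ℝ) :=
  Measurable.ite (measurableSet_le measurable_norm measurable_const) measurable_const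
    (measurable_norm.pow_const _)

theorem testFun_nonneg (β R : ℝ) (x : Eucl N) : 0 ≤ testFun β R x := by
  unfold testFun; split_ifs
  · exact zero_le_one
  · exact tail_nonneg _ _ _

theorem barrier_pos (β : ℝ) (x : Eucl N) : 0 < barrier β x := by
  unfold barrier; split_ifs with h
  · exact zero_lt_one
  · exact Real.rpow_pos_of_pos (zero_lt_one.trans (not_le.1 h)) _

theorem barrier_le_one {β : ℝ} (hβ : 0 < β) (x : Eucl N) : barrier β x ≤ 1 := by
  unfold barrier; split_ifs with h
  · exact le_rfl
  · exact Real.rpow_le_one_of_one_le_of_nonpos (not_le.1 h).le (by linarith)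

theorem testFun_le_barrier (β R : ℝ) (x : Eucl N) : testFun β R x ≤ barrier β x := by
  unfold testFun barrier; split_ifs
  · exact le_rfl
  · exact mul_le_of_le_one_right (by positivity) (cutoff_le_one _)

theorem testFun_le_one {β : ℝ} (hβ : 0 < β) (R : ℝ) (x : Eucl N) : testFun β R x ≤ 1 :=
  (testFun_le_barrier β R x).trans (barrier_le_one hβ x)

theorem testFun_eq_zero {β R : ℝ} (hR : 1 ≤ R) {x : Eucl N} (hx : R < ‖x‖) :
    testFun β R x = 0 := by
  have hR0 : 0 < R := by linarith
  rw [testFun, if_neg (by linarith), tail, cutoff_of_ge, mul_zero]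
  rw [one_le_div (by positivity)]
  gcongr

/-- The cutoff is evaluated at `|x|²/R²`, so its threshold `1/4` corresponds to radius `R/2`. -/
theorem testFun_eq_barrier {β R : ℝ} (hR : 0 < R) {x : Eucl N} (hx : ‖x‖ ≤ R / 2) :
    testFun β R x = barrier β x := by
  unfold testFun barrier
  split_ifs
  · rfl
  · rw [tail, cutoff_of_le, mul_one]
    rw [div_le_iff₀ (by positivity)]
    nlinarith [norm_nonneg x]

/-- With `R ≥ 2` the cutoff equals `1` on the unit ball. Together with equality for `|x| ≥ 1`, this
lets second differences of the smooth tail bound those of the test function from above, despite the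
kink on the unit sphere. -/
theorem testFun_le_tail {β R : ℝ} (hβ : 0 < β) (hR : 2 ≤ R) {x : Eucl N} (hx : x ≠ 0) :
    testFun β R x ≤ tail β R x := by
  unfold testFun
  split_ifs with h
  · have hxp := norm_pos_iff.2 hx
    rw [tail, cutoff_of_le, mul_one]
    · exact Real.one_le_rpow_of_pos_of_le_one_of_nonpos hxp h (by linarith)
    · rw [div_le_iff₀ (by positivity)]
      nlinarith [norm_nonneg x]
  · exact le_rfl

theorem testFun_eq_tail {β R : ℝ} (hR : 2 ≤ R) {x : Eucl N} (hx : 1 ≤ ‖x‖) :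
    testFun β R x = tail β R x := by
  rcases hx.eq_or_lt with h | h
  · rw [testFun, if_pos h.ge, tail, ← h, Real.one_rpow, cutoff_of_le, mul_one]
    rw [div_le_iff₀ (by positivity)]
    nlinarith
  · rw [testFun, if_neg (not_le.2 h)]

theorem decayIntegrable_testFun {q β : ℝ} (hq : (N : ℝ) < q) (hβ : 0 < β) (R : ℝ) :
    DecayIntegrable q (testFun β R : Eucl N → ℝ) :=
  decayIntegrable_of_bounded hq (measurable_testFun β R).aestronglyMeasurable (M := 1)
    fun x => by rw [abs_of_nonneg (testFun_nonneg β R x)]; exact testFun_le_one hβ R x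

theorem decayIntegrable_barrier {q β : ℝ} (hq : (N : ℝ) < q) (hβ : 0 < β) :
    DecayIntegrable q (barrier β : Eucl N → ℝ) :=
  decayIntegrable_of_bounded hq (measurable_barrier β).aestronglyMeasurable (M := 1)
    fun x => by rw [abs_of_nonneg (barrier_pos β x).le]; exact barrier_le_one hβ x

/-- At a maximum point the truncated fractional Laplacian is nonnegative. -/
theorem truncFL_testFun_nonneg {q ε β : ℝ} (hβ : 0 < β) (R : ℝ) {x : Eucl N} (hx : ‖x‖ ≤ 1) :
    0 ≤ truncFL q ε (testFun β R) x := by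
  refine integral_nonneg fun y => mul_nonneg ?_ (truncKernel_nonneg _ _ _)
  rw [sub_nonneg, show testFun β R x = 1 by rw [testFun, if_pos hx]]
  exact testFun_le_one hβ R y

theorem truncFL_barrier_le {q ε β R : ℝ} (hq : (N : ℝ) < q) (hε : 0 < ε) (hβ : 0 < β) (hR : 0 < R)
    {x : Eucl N} (hx : ‖x‖ ≤ R / 2) :
    truncFL q ε (barrier β) x ≤ truncFL q ε (testFun β R) x := by
  refine integral_mono ((decayIntegrable_barrier hq hβ).integrable_sub_mul_truncKernel hq hε x _)
    ((decayIntegrable_testFun hq hβ R).integrable_sub_mul_truncKernel hq hε x _) fun y => ?_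
  simp only
  rw [testFun_eq_barrier hR hx]
  have := testFun_le_barrier β R y
  have := truncKernel_nonneg q ε (x - y)
  gcongr

/-! ### Lower bounds for the truncated operators on test functions -/

/-- The mass of the barrier in the ball of radius `r`. -/
noncomputable def barrierMass (N : ℕ) (β r : ℝ) : ℝ :=
  ∫ y : Eucl N, if ‖y‖ ≤ r then barrier β y else 0

theorem integrable_barrier_ball {β : ℝ} (hβ : 0 < β) (r : ℝ) :
    Integrable (fun y : Eucl N => if ‖y‖ ≤ r then barrier β y else 0) := by
  refine integrable_of_bounded_of_support (M := 1) (R := r)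
    (Measurable.ite (measurableSet_le measurable_norm measurable_const)
      (measurable_barrier β) measurable_const) (fun x hx => ?_) fun x hx => if_neg (not_le.2 hx)
  rw [if_pos hx, abs_of_nonneg (barrier_pos β x).le]
  exact barrier_le_one hβ x

/-- Averaging over `z` and `-z` turns first differences into second differences. -/
theorem integral_le_half_of_symm_le {f g : Eucl N → ℝ} (hf : Integrable f) (hg : Integrable g)
    (h : ∀ z, f z + f (-z) ≤ g z) : ∫ z, f z ≤ (∫ z, g z) / 2 := by
  have h1 : ∫ z, (f z + f (-z)) ≤ ∫ z, g z := integral_mono (hf.add hf.comp_neg) hg h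
  rw [integral_add hf hf.comp_neg, integral_neg_eq_self f volume] at h1
  linarith

theorem integrable_truncKernel_zero {q ε : ℝ} (hq : (N : ℝ) < q) (hε : 0 < ε) :
    Integrable (fun z : Eucl N => truncKernel q ε z) := by
  have := integrable_truncKernel hq hε (0 : Eucl N)
  simpa [truncKernel_neg] using this

theorem integrable_testFun_diff_near {q ε β : ℝ} (hq : (N : ℝ) < q) (hε : 0 < ε) (hβ : 0 < β)
    (R r : ℝ) (x : Eucl N) :
    Integrable (fun z : Eucl N => (if ‖z‖ < r then testFun β R (x - z) - testFun β R x else 0) *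
      truncKernel q ε z) := by
  refine (integrable_truncKernel_zero hq hε).bdd_mul (c := 2) ?_ (Eventually.of_forall fun z => ?_)
  · exact (Measurable.ite (measurableSet_lt measurable_norm measurable_const)
      (((measurable_testFun β R).comp (measurable_const.sub measurable_id)).sub_const _)
      measurable_const).aestronglyMeasurable
  · have a1 := testFun_nonneg β R x
    have a2 := testFun_nonneg β R (x - z)
    have a3 := testFun_le_one hβ R x
    have a4 := testFun_le_one hβ R (x - z)
    split_ifs
    · rw [Real.norm_eq_abs, abs_le]; constructor <;> linarith
    · simp

theorem integrable_testFun_diff_far {q ε β : ℝ} (hq : (N : ℝ) < q) (hε : 0 < ε) (hβ : 0 < β)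
    (R r : ℝ) (x : Eucl N) :
    Integrable (fun z : Eucl N => (if ‖z‖ < r then 0 else testFun β R (x - z) - testFun β R x) *
      truncKernel q ε z) := by
  refine (integrable_truncKernel_zero hq hε).bdd_mul (c := 2) ?_ (Eventually.of_forall fun z => ?_)
  · exact (Measurable.ite (measurableSet_lt measurable_norm measurable_const) measurable_const
      (((measurable_testFun β R).comp (measurable_const.sub measurable_id)).sub_const _)
      ).aestronglyMeasurable
  · have a1 := testFun_nonneg β R x
    have a2 := testFun_nonneg β R (x - z)
    have a3 := testFun_le_one hβ R x
    have a4 := testFun_le_one hβ R (x - z)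
    split_ifs
    · simp
    · rw [Real.norm_eq_abs, abs_le]; constructor <;> linarith

/-- The second difference bound `|x|^{-β-2} |z|²`, integrated against `|z|^{-N-2s}` over `|z| <
|x|/2`, contributes a factor `|x|^{2-2s}`. -/
theorem exists_bound_near_testFun (hN : 1 ≤ N) {s β : ℝ} (hs₁ : s < 1) (hs₀ : 0 < s) (hβ : 0 < β) :
    ∃ C : ℝ, 0 ≤ C ∧ ∀ R ε, 2 ≤ R → 0 < ε → ∀ x : Eucl N, 1 ≤ ‖x‖ →
      ∫ z : Eucl N, (if ‖z‖ < ‖x‖ / 2 then testFun β R (x - z) - testFun β R x else 0) *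
        truncKernel ((N : ℝ) + 2 * s) ε z ≤ C * ‖x‖ ^ (-β - 2 * s) := by
  obtain ⟨C, hC0, hC⟩ := exists_bound_second_diff_tail (N := N) hβ
  set q : ℝ := (N : ℝ) + 2 * s with hqdef
  have hq : (N : ℝ) < q := by rw [hqdef]; linarith
  set V : ℝ := N * volume.real (Metric.ball (0 : Eucl N) 1) / (N + (2 - q)) with hV
  have hV0 : 0 ≤ V := by
    have : 0 < (N : ℝ) + (2 - q) := by rw [hqdef]; linarith
    positivity
  refine ⟨C * V * (1 / 2) ^ (2 - 2 * s) / 2, by positivity, fun R ε hR hε x hx => ?_⟩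
  have hx0 : 0 < ‖x‖ := by linarith
  have hxne : x ≠ 0 := norm_pos_iff.1 hx0
  have hr : 0 < ‖x‖ / 2 := by positivity
  have hint := integrable_testFun_diff_near hq hε hβ R (‖x‖ / 2) x
  have hb : -(N : ℝ) < 2 - q := by rw [hqdef]; linarith
  have hbi := (integrable_ballPow hN hb hr).const_mul (C * ‖x‖ ^ (-β - 2))
  have hle := integral_le_half_of_symm_le hint hbi fun z => by
    rw [norm_neg, truncKernel_neg, ← add_mul]
    have hk0 := truncKernel_nonneg q ε z
    by_cases hz : ‖z‖ < ‖x‖ / 2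
    · rw [if_pos hz, if_pos hz, ballPow, if_pos hz]
      have n1 : x - z ≠ 0 := fun h => by
        rw [sub_eq_zero] at h; rw [← h] at hz; linarith
      have n2 : x + z ≠ 0 := fun h => by
        rw [eq_neg_of_add_eq_zero_right h, norm_neg] at hz; linarith
      have t1 := testFun_le_tail hβ hR n1
      have t2 := testFun_le_tail hβ hR n2
      have t3 := testFun_eq_tail (β := β) hR hx
      have t4 := hC R (by linarith) x z hxne hz.le
      rw [sub_neg_eq_add]
      calc _ ≤ (C * ‖x‖ ^ (-β - 2) * ‖z‖ ^ 2) * truncKernel q ε z := by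
            refine mul_le_mul_of_nonneg_right ?_ hk0
            linarith
        _ ≤ _ := by
          rw [mul_assoc]
          refine mul_le_mul_of_nonneg_left ?_ (by positivity)
          unfold truncKernel
          split_ifs with h
          · have hz0 : 0 < ‖z‖ := hε.trans_le h
            rw [Real.rpow_sub hz0, Real.rpow_two, mul_one_div]
          · rw [mul_zero]; positivity
    · rw [if_neg hz, if_neg hz, ballPow, if_neg hz]; simp
  refine hle.trans_eq ?_
  rw [integral_const_mul, integral_ballPow hN hb hr, ← hV,
    show (N : ℝ) + (2 - q) = 2 - 2 * s by rw [hqdef]; ring, div_eq_mul_one_div ‖x‖ 2,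
    Real.mul_rpow hx0.le (by norm_num), show -β - 2 * s = (-β - 2) + (2 - 2 * s) by ring,
    Real.rpow_add hx0]
  ring

theorem barrier_le_of_lt {β r : ℝ} (hβ : 0 < β) (hr : 1 ≤ r) {y : Eucl N} (hy : r < ‖y‖) :
    barrier β y ≤ r ^ (-β) := by
  rw [barrier, if_neg (by linarith)]
  exact Real.rpow_le_rpow_of_nonpos (by linarith) hy.le (by linarith)

/-- Write `y = x - z`. Where `|y| ≤ |x|` the kernel is at most `(|x|/2)^{-q}`, leaving the mass of
the barrier; where `|y| > |x|` the barrier is at most `|x|^{-β}`, and the kernel has mass of order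
`|x|^{-2s}`. -/
theorem exists_bound_far_testFun (hN : 1 ≤ N) {s β : ℝ} (hs₀ : 0 < s) (hβ : 0 < β) :
    ∃ C : ℝ, 0 ≤ C ∧ ∀ R ε, 2 ≤ R → 0 < ε → ∀ x : Eucl N, 1 ≤ ‖x‖ →
      ∫ z : Eucl N, (if ‖z‖ < ‖x‖ / 2 then 0 else testFun β R (x - z) - testFun β R x) *
        truncKernel ((N : ℝ) + 2 * s) ε z ≤
      C * (‖x‖ ^ (-β - 2 * s) + ‖x‖ ^ (-((N : ℝ) + 2 * s)) * barrierMass N β ‖x‖) := by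
  set q : ℝ := (N : ℝ) + 2 * s with hqdef
  have hq : (N : ℝ) < q := by rw [hqdef]; linarith
  set V : ℝ := N * volume.real (Metric.ball (0 : Eucl N) 1) / (q - N) with hV
  have hV0 : 0 ≤ V := by
    have : 0 < q - (N : ℝ) := by linarith
    positivity
  refine ⟨V * (1 / 2) ^ (-(2 * s)) + (1 / 2) ^ (-q), by positivity, fun R ε hR hε x hx => ?_⟩
  have hx0 : 0 < ‖x‖ := by linarith
  have hr : 0 < ‖x‖ / 2 := by positivity
  have hint := integrable_testFun_diff_far hq hε hβ R (‖x‖ / 2) x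
  have hmass : Integrable (fun z : Eucl N => if ‖x - z‖ ≤ ‖x‖ then barrier β (x - z) else 0) :=
    (integrable_barrier_ball hβ ‖x‖).comp_sub_left x
  have hmass' : ∫ z : Eucl N, (if ‖x - z‖ ≤ ‖x‖ then barrier β (x - z) else 0) =
      barrierMass N β ‖x‖ :=
    integral_sub_left_eq_self (fun y : Eucl N => if ‖y‖ ≤ ‖x‖ then barrier β y else 0) volume x
  have hmass0 : 0 ≤ barrierMass N β ‖x‖ := integral_nonneg fun y => by
    simp only [Pi.zero_apply]; split_ifs
    · exact (barrier_pos β y).le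
    · exact le_rfl
  calc _ ≤ ∫ z : Eucl N, ((‖x‖ / 2) ^ (-q) *
        (if ‖x - z‖ ≤ ‖x‖ then barrier β (x - z) else 0) +
          ‖x‖ ^ (-β) * truncKernel q (‖x‖ / 2) z) := by
        refine integral_mono hint ((hmass.const_mul _).add ((integrable_truncKernel_zero hq hr).const_mul _)) fun z => ?_
        have hk1 := truncKernel_nonneg q ε z
        have hk2 := truncKernel_nonneg q (‖x‖ / 2) z
        have hm0 : 0 ≤ (if ‖x - z‖ ≤ ‖x‖ then barrier β (x - z) else 0) := by
          split_ifs
          · exact (barrier_pos β _).le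
          · exact le_rfl
        simp only
        by_cases hz : ‖z‖ < ‖x‖ / 2
        · rw [if_pos hz, zero_mul]; positivity
        rw [if_neg hz]
        have hz' := not_lt.1 hz
        have hz0 : 0 < ‖z‖ := hr.trans_le hz'
        have hkk : truncKernel q ε z ≤ truncKernel q (‖x‖ / 2) z := by
          unfold truncKernel
          rw [if_pos hz']
          split_ifs
          · exact le_rfl
          · positivity
        have hk3 : truncKernel q (‖x‖ / 2) z ≤ (‖x‖ / 2) ^ (-q) := by
          rw [truncKernel, if_pos hz', one_div, ← Real.rpow_neg hz0.le]
          exact Real.rpow_le_rpow_of_nonpos hr hz' (by linarith [Nat.cast_nonneg (α := ℝ) N])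
        calc _ ≤ barrier β (x - z) * truncKernel q (‖x‖ / 2) z := by
              refine mul_le_mul ?_ hkk hk1 (barrier_pos β _).le
              linarith [testFun_le_barrier β R (x - z), testFun_nonneg β R x]
          _ ≤ _ := by
            by_cases hb : ‖x - z‖ ≤ ‖x‖
            · rw [if_pos hb]
              have h0 := (barrier_pos β (x - z)).le
              have : barrier β (x - z) * truncKernel q (‖x‖ / 2) z ≤
                  barrier β (x - z) * (‖x‖ / 2) ^ (-q) := by gcongr
              have h1 : 0 ≤ ‖x‖ ^ (-β) * truncKernel q (‖x‖ / 2) z := by positivity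
              linarith
            · rw [if_neg hb, mul_zero, zero_add]
              have := barrier_le_of_lt hβ hx (not_le.1 hb)
              gcongr
    _ = (‖x‖ / 2) ^ (-q) * barrierMass N β ‖x‖ + ‖x‖ ^ (-β) * (V * (‖x‖ / 2) ^ ((N : ℝ) - q)) := by
        rw [integral_add (hmass.const_mul _) ((integrable_truncKernel_zero hq hr).const_mul _), integral_const_mul,
          integral_const_mul, hmass', integral_truncKernel_eq hN hq hr]
    _ = (1 / 2) ^ (-q) * (‖x‖ ^ (-q) * barrierMass N β ‖x‖) +
          V * (1 / 2) ^ (-(2 * s)) * ‖x‖ ^ (-β - 2 * s) := by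
        rw [show (N : ℝ) - q = -(2 * s) by rw [hqdef]; ring, div_eq_mul_one_div ‖x‖ 2,
          Real.mul_rpow hx0.le (by norm_num), Real.mul_rpow hx0.le (by norm_num),
          show -β - 2 * s = -β + -(2 * s) by ring, Real.rpow_add hx0]
        ring
    _ ≤ _ := by
        have h1 : 0 ≤ V * (1 / 2 : ℝ) ^ (-(2 * s)) := by positivity
        have h2 : (0 : ℝ) ≤ (1 / 2 : ℝ) ^ (-q) := by positivity
        have h3 : 0 ≤ ‖x‖ ^ (-q) * barrierMass N β ‖x‖ := by positivity
        have h4 : 0 ≤ ‖x‖ ^ (-β - 2 * s) := by positivity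
        nlinarith [mul_nonneg h1 h3, mul_nonneg h2 h4]

theorem exists_bound_truncFL_testFun (hN : 1 ≤ N) {s β : ℝ} (hs₀ : 0 < s) (hs₁ : s < 1)
    (hβ : 0 < β) :
    ∃ C : ℝ, 0 ≤ C ∧ ∀ R ε, 2 ≤ R → 0 < ε → ∀ x : Eucl N, 1 ≤ ‖x‖ →
      -truncFL ((N : ℝ) + 2 * s) ε (testFun β R) x ≤
        C * (‖x‖ ^ (-β - 2 * s) + ‖x‖ ^ (-((N : ℝ) + 2 * s)) * barrierMass N β ‖x‖) := by
  obtain ⟨C₁, hC₁, h₁⟩ := exists_bound_near_testFun (N := N) hN hs₁ hs₀ hβ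
  obtain ⟨C₂, hC₂, h₂⟩ := exists_bound_far_testFun (N := N) hN hs₀ hβ
  have hq : (N : ℝ) < (N : ℝ) + 2 * s := by linarith
  refine ⟨C₁ + C₂, by positivity, fun R ε hR hε x hx => ?_⟩
  have e : -truncFL ((N : ℝ) + 2 * s) ε (testFun β R) x =
      (∫ z : Eucl N, (if ‖z‖ < ‖x‖ / 2 then testFun β R (x - z) - testFun β R x else 0) *
        truncKernel ((N : ℝ) + 2 * s) ε z) +
      ∫ z : Eucl N, (if ‖z‖ < ‖x‖ / 2 then 0 else testFun β R (x - z) - testFun β R x) *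
        truncKernel ((N : ℝ) + 2 * s) ε z := by
    rw [truncFL_eq_integral, ← integral_neg, ← integral_add
      (integrable_testFun_diff_near hq hε hβ R (‖x‖ / 2) x)
      (integrable_testFun_diff_far hq hε hβ R (‖x‖ / 2) x)]
    congr 1
    ext z
    split_ifs <;> ring
  have hmass0 : 0 ≤ barrierMass N β ‖x‖ := integral_nonneg fun y => by
    simp only [Pi.zero_apply]; split_ifs
    · exact (barrier_pos β y).le
    · exact le_rfl
  have h3 : 0 ≤ ‖x‖ ^ (-((N : ℝ) + 2 * s)) * barrierMass N β ‖x‖ := by positivity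
  have := h₁ R ε hR hε x hx
  have := h₂ R ε hR hε x hx
  rw [e]
  nlinarith [mul_nonneg hC₁ h3]

/-! ### Superharmonicity of the truncated fundamental solution -/

theorem abs_det_smul_reflection (k : ℝ) (K : Submodule ℝ (Eucl N)) [K.HasOrthogonalProjection] :
    |(k • (K.reflection : Eucl N →L[ℝ] Eucl N)).det| = |k| ^ N := by
  have h1 : (K.reflection : Eucl N →L[ℝ] Eucl N).det * (K.reflection : Eucl N →L[ℝ] Eucl N).det
      = 1 := by
    rw [ContinuousLinearMap.det, ← LinearMap.det_comp]
    refine Eq.trans (congrArg LinearMap.det ?_) (LinearMap.det_id (M := Eucl N) (A := ℝ))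
    ext1 x
    simp
  have h2 : |(K.reflection : Eucl N →L[ℝ] Eucl N).det| = 1 := by
    have := congrArg abs h1
    rw [abs_mul, abs_one] at this
    nlinarith [abs_nonneg (K.reflection : Eucl N →L[ℝ] Eucl N).det]
  have h3 : (k • (K.reflection : Eucl N →L[ℝ] Eucl N)).det =
      k ^ N * (K.reflection : Eucl N →L[ℝ] Eucl N).det := by
    rw [ContinuousLinearMap.det, ContinuousLinearMap.toLinearMap_smul, LinearMap.det_smul,
      finrank_euclideanSpace, Fintype.card_fin]
  rw [h3, abs_mul, h2, mul_one, abs_pow]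

theorem barrier_antitone {β : ℝ} (hβ : 0 < β) {x y : Eucl N} (h : ‖x‖ ≤ ‖y‖) :
    barrier β y ≤ barrier β x := by
  unfold barrier
  split_ifs with h1 h2 h2
  · exact le_rfl
  · linarith
  · exact Real.rpow_le_one_of_one_le_of_nonpos (not_le.1 h1).le (by linarith)
  · exact Real.rpow_le_rpow_of_nonpos (by linarith) h (by linarith)

theorem barrier_le_rpow {β : ℝ} (hβ : 0 < β) {x : Eucl N} (hx : x ≠ 0) :
    barrier β x ≤ ‖x‖ ^ (-β) := by
  unfold barrier
  split_ifs with h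
  · exact Real.one_le_rpow_of_pos_of_le_one_of_nonpos (norm_pos_iff.2 hx) h (by linarith)
  · exact le_rfl

/-- Inversion in the sphere through `x` maps the part of the truncated integral where the barrier
exceeds its value at `x` into the part where it lies below. -/
theorem barrier_inversion_le {s ε : ℝ} (hNs : 2 * s < N) (hε : 0 < ε)
    {x y : Eucl N} (hx : 1 < ‖x‖) (hy0 : y ≠ 0) (hy : ‖y‖ < ‖x‖) :
    -((barrier (N - 2 * s) x - barrier (N - 2 * s) y) * truncKernel (N + 2 * s) ε (x - y)) ≤
      (‖x‖ / ‖y‖) ^ (2 * N) * ((barrier (N - 2 * s) x -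
        barrier (N - 2 * s) (EuclideanGeometry.inversion 0 ‖x‖ y)) *
          truncKernel (N + 2 * s) ε (x - EuclideanGeometry.inversion 0 ‖x‖ y)) := by
  set i : Eucl N := EuclideanGeometry.inversion 0 ‖x‖ y with hi
  set β : ℝ := N - 2 * s with hβdef
  set q : ℝ := N + 2 * s with hqdef
  have hβ : 0 < β := by rw [hβdef]; linarith
  have hx0 : 0 < ‖x‖ := by linarith
  have hyp : 0 < ‖y‖ := norm_pos_iff.2 hy0
  have hni : ‖i‖ = ‖x‖ ^ 2 / ‖y‖ := by
    have := EuclideanGeometry.dist_inversion_center (0 : Eucl N) y ‖x‖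
    simpa using this
  have hxi : ‖x‖ < ‖i‖ := by
    rw [hni, lt_div_iff₀ hyp]; nlinarith
  have hd : ‖x - i‖ = ‖x‖ / ‖y‖ * ‖x - y‖ := by
    have h1 := EuclideanGeometry.dist_inversion_inversion (c := (0 : Eucl N))
      (norm_pos_iff.1 hx0) hy0 ‖x‖
    have h2 : EuclideanGeometry.inversion (0 : Eucl N) ‖x‖ x = x :=
      EuclideanGeometry.inversion_of_mem_sphere (by simp)
    rw [h2, ← hi, dist_zero_right, dist_zero_right, dist_eq_norm, dist_eq_norm] at h1
    rw [h1]; field_simp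
  have hwi : barrier β i ≤ barrier β x := barrier_antitone hβ hxi.le
  by_cases hεy : ε ≤ ‖x - y‖
  swap
  · have h0 : truncKernel q ε (x - y) = 0 := by rw [truncKernel, if_neg hεy]
    rw [h0, mul_zero, neg_zero]
    have := truncKernel_nonneg q ε (x - i)
    have := sub_nonneg.2 hwi
    positivity
  have hxy : 0 < ‖x - y‖ := hε.trans_le hεy
  -- Inversion moves inner points away from `x`, so the mirror image of a point kept by the
  -- truncation is also kept.
  have hεi : ε ≤ ‖x - i‖ := by
    rw [hd]
    refine hεy.trans (le_mul_of_one_le_left hxy.le ?_)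
    rw [one_le_div hyp]; exact hy.le
  have hwx : barrier β x = ‖x‖ ^ (-β) := by rw [barrier, if_neg (by linarith)]
  have hwi' : barrier β i = (‖x‖ ^ 2 / ‖y‖) ^ (-β) := by
    rw [barrier, if_neg (by linarith), hni]
  have hwy := barrier_le_rpow hβ hy0
  rw [truncKernel, if_pos hεy, truncKernel, if_pos hεi, hwx, hwi', hd]
  have hk : 0 ≤ 1 / ‖x - y‖ ^ q := by positivity
  -- Replacing the barrier at `y` by the larger pure power only worsens the left side; for pure
  -- powers the two sides agree exactly, because `q + β = 2N`.
  calc -((‖x‖ ^ (-β) - barrier β y) * (1 / ‖x - y‖ ^ q))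
      ≤ (‖y‖ ^ (-β) - ‖x‖ ^ (-β)) * (1 / ‖x - y‖ ^ q) := by
        rw [← neg_mul, neg_sub]; gcongr
    _ = _ := by
        have e1 : (‖x‖ / ‖y‖) ^ (2 * N) = ‖x‖ ^ (q + β) / ‖y‖ ^ (q + β) := by
          rw [← Real.div_rpow hx0.le hyp.le, ← Real.rpow_natCast]
          congr 1
          push_cast
          rw [hqdef, hβdef]; ring
        have e2 : (‖x‖ ^ 2 / ‖y‖) ^ (-β) = ‖x‖ ^ (-β) * ‖x‖ ^ (-β) / ‖y‖ ^ (-β) := by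
          rw [Real.div_rpow (by positivity) hyp.le, sq, Real.mul_rpow hx0.le hx0.le]
        rw [e1, e2, Real.mul_rpow (by positivity) hxy.le, Real.div_rpow hx0.le hyp.le,
          Real.rpow_neg hx0.le, Real.rpow_neg hyp.le, Real.rpow_add hx0, Real.rpow_add hyp]
        have : 0 < ‖x‖ ^ q := by positivity
        have : 0 < ‖y‖ ^ q := by positivity
        have : 0 < ‖x‖ ^ β := by positivity
        have : 0 < ‖y‖ ^ β := by positivity
        have : 0 < ‖x - y‖ ^ q := by positivity
        field_simp

/-- The truncated barrier `min(1, |x|^{2s-N})` of the fundamental solution is superharmonic, for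
every truncation of the kernel. -/
theorem truncFL_barrier_nonneg (hN : 1 ≤ N) {s ε : ℝ} (hs : 0 < s) (hNs : 2 * s < N) (hε : 0 < ε)
    (x : Eucl N) : 0 ≤ truncFL ((N : ℝ) + 2 * s) ε (barrier (N - 2 * s)) x := by
  have hβ : 0 < (N : ℝ) - 2 * s := by linarith
  have hq : (N : ℝ) < N + 2 * s := by linarith
  rcases le_or_gt ‖x‖ 1 with hx | hx
  · refine integral_nonneg fun y => mul_nonneg ?_ (truncKernel_nonneg _ _ _)
    rw [sub_nonneg, show barrier (N - 2 * s) x = 1 by rw [barrier, if_pos hx]]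
    exact barrier_le_one hβ y
  have hx0 : 0 < ‖x‖ := by linarith
  have : Nonempty (Fin N) := ⟨⟨0, hN⟩⟩
  set h : Eucl N → ℝ := fun y =>
    (barrier (N - 2 * s) x - barrier (N - 2 * s) y) * truncKernel (N + 2 * s) ε (x - y) with hh
  have hint : Integrable h :=
    (decayIntegrable_barrier hq hβ).integrable_sub_mul_truncKernel hq hε x _
  set I : Set (Eucl N) := {y | y ≠ 0 ∧ ‖y‖ < ‖x‖} with hI
  have hIm : MeasurableSet I := by
    have : I = {0}ᶜ ∩ Metric.ball 0 ‖x‖ := by ext y; simp [hI]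
    rw [this]
    exact (measurableSet_singleton _).compl.inter Metric.isOpen_ball.measurableSet
  -- Negative values of `h` occur only for `|y| < |x|`. The Jacobian of inversion is
  -- `(|x|/|y|)^{2N}`, so the pointwise comparison bounds the negative part by the positive part
  -- over the image.
  have key : ∫⁻ y, ENNReal.ofReal (-h y) ≤ ∫⁻ y, ENNReal.ofReal (h y) := by
    calc ∫⁻ y, ENNReal.ofReal (-h y) ≤ ∫⁻ y in I, ENNReal.ofReal (-h y) := by
          rw [← lintegral_indicator hIm]
          have hae : ∀ᵐ y : Eucl N, y ≠ 0 := by simp [ae_iff]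
          refine lintegral_mono_ae (hae.mono fun y hy => ?_)
          by_cases hyI : y ∈ I
          · rw [Set.indicator_of_mem hyI]
          · rw [Set.indicator_of_notMem hyI]
            have hxy : ‖x‖ ≤ ‖y‖ := by
              by_contra hlt
              exact hyI ⟨hy, not_le.1 hlt⟩
            have h1 := sub_nonneg.2 (barrier_antitone hβ hxy)
            have h2 : 0 ≤ h y := mul_nonneg h1 (truncKernel_nonneg _ _ _)
            rw [ENNReal.ofReal_of_nonpos (by linarith)]
      _ ≤ ∫⁻ y in I, ENNReal.ofReal |((‖x‖ / dist y 0) ^ 2 •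
            (((ℝ ∙ (y - 0))ᗮ.reflection : Eucl N ≃ₗᵢ[ℝ] Eucl N) : Eucl N →L[ℝ] Eucl N)).det| *
              ENNReal.ofReal (h (EuclideanGeometry.inversion 0 ‖x‖ y)) := by
          refine setLIntegral_mono' hIm fun y hy => ?_
          rw [← ENNReal.ofReal_mul (abs_nonneg _), abs_det_smul_reflection, dist_zero_right,
            abs_of_nonneg (by positivity : 0 ≤ (‖x‖ / ‖y‖) ^ 2), ← pow_mul]
          exact ENNReal.ofReal_le_ofReal (barrier_inversion_le hNs hε hx hy.1 hy.2)
      _ = ∫⁻ y in EuclideanGeometry.inversion 0 ‖x‖ '' I, ENNReal.ofReal (h y) :=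
          (lintegral_image_eq_lintegral_abs_det_fderiv_mul volume hIm
            (fun y hy => (EuclideanGeometry.hasFDerivAt_inversion hy.1).hasFDerivWithinAt)
            (EuclideanGeometry.inversion_injective 0 hx0.ne').injOn
            (fun y => ENNReal.ofReal (h y))).symm
      _ ≤ ∫⁻ y, ENNReal.ofReal (h y) := setLIntegral_le_lintegral _ _
  rw [truncFL, integral_eq_lintegral_pos_part_sub_lintegral_neg_part hint, sub_nonneg]
  exact ENNReal.toReal_mono hint.lintegral_lt_top.ne key

/-! ### Growth of the barrier mass -/

theorem barrier_eq_rpow {β : ℝ} {x : Eucl N} (hx : 1 ≤ ‖x‖) : barrier β x = ‖x‖ ^ (-β) := by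
  rcases hx.eq_or_lt with h | h
  · rw [barrier, if_pos h.ge, ← h, Real.one_rpow]
  · rw [barrier, if_neg (not_le.2 h)]

theorem exists_barrierMass_le_of_lt (hN : 1 ≤ N) {β : ℝ} (hβ : 0 < β) (hβN : β < N) :
    ∃ C : ℝ, 0 ≤ C ∧ ∀ r, 1 ≤ r → barrierMass N β r ≤ C * r ^ ((N : ℝ) - β) := by
  have : Nonempty (Fin N) := ⟨⟨0, hN⟩⟩
  set V : ℝ := N * volume.real (Metric.ball (0 : Eucl N) 1) / (N + -β) with hV
  have hV0 : 0 ≤ V := by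
    have : 0 < (N : ℝ) + -β := by linarith
    positivity
  refine ⟨V * 2 ^ ((N : ℝ) - β), by positivity, fun r hr => ?_⟩
  have hb : -(N : ℝ) < -β := by linarith
  have hr2 : 0 < 2 * r := by linarith
  -- Radius `2r` absorbs the difference between the closed ball here and the strict inequality in
  -- `ballPow`.
  calc barrierMass N β r ≤ ∫ y : Eucl N, ballPow (-β) (2 * r) y := by
        have hae : ∀ᵐ y : Eucl N, y ≠ 0 := by simp [ae_iff]
        refine integral_mono_ae (integrable_barrier_ball hβ r) (integrable_ballPow hN hb hr2)
          (hae.mono fun y hy => ?_)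
        simp only
        split_ifs with h
        · rw [ballPow, if_pos (by linarith)]
          exact barrier_le_rpow hβ hy
        · exact ballPow_nonneg _ _ _
    _ = _ := by
        rw [integral_ballPow hN hb hr2, ← hV, Real.mul_rpow (by norm_num) (by linarith),
          ← sub_eq_add_neg]
        ring

theorem barrierMass_le_of_gt (hN : 1 ≤ N) {β : ℝ} (hβ : (N : ℝ) < β) (r : ℝ) :
    barrierMass N β r ≤ volume.real (Metric.closedBall (0 : Eucl N) 1) +
      N * volume.real (Metric.ball (0 : Eucl N) 1) / (β - N) := by
  have hβ0 : 0 < β := (Nat.cast_nonneg N).trans_lt hβ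
  have hind : Integrable ((Metric.closedBall (0 : Eucl N) 1).indicator fun _ => (1 : ℝ)) :=
    (integrable_indicator_iff Metric.isClosed_closedBall.measurableSet).2
      (integrableOn_const measure_closedBall_lt_top.ne)
  have hk := integrable_truncKernel_zero (N := N) hβ one_pos
  calc barrierMass N β r ≤ ∫ y : Eucl N, ((Metric.closedBall (0 : Eucl N) 1).indicator
        (fun _ => (1 : ℝ)) y + truncKernel β 1 y) := by
        refine integral_mono (integrable_barrier_ball hβ0 r) (hind.add hk) fun y => ?_
        have h0 := truncKernel_nonneg β 1 y
        have h1 : barrier β y ≤ (Metric.closedBall (0 : Eucl N) 1).indicator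
            (fun _ => (1 : ℝ)) y + truncKernel β 1 y := by
          by_cases hy : ‖y‖ ≤ 1
          · rw [Set.indicator_of_mem (by simpa using hy)]
            linarith [barrier_le_one hβ0 y]
          · rw [Set.indicator_of_notMem (by simpa using hy), zero_add, barrier, if_neg hy,
              truncKernel, if_pos (not_le.1 hy).le, one_div, Real.rpow_neg (norm_nonneg y)]
        simp only
        split_ifs
        · exact h1
        · exact (barrier_pos β y).le.trans h1
    _ = _ := by
        rw [integral_add hind hk, integral_indicator Metric.isClosed_closedBall.measurableSet,
          integral_truncKernel_eq hN hβ one_pos, Real.one_rpow]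
        simp

theorem exists_barrierMass_le_log (hN : 1 ≤ N) :
    ∃ C : ℝ, 0 ≤ C ∧ ∀ r, 1 ≤ r → barrierMass N N r ≤ C * (1 + Real.log r) := by
  have hNp : (0 : ℝ) < N := by exact_mod_cast hN
  set v := volume.real (Metric.closedBall (0 : Eucl N) 1)
  set V := N * volume.real (Metric.ball (0 : Eucl N) 1)
  have hv : 0 ≤ v := by positivity
  have hV : 0 ≤ V := by positivity
  refine ⟨Real.exp 1 * (v + V), by positivity, fun r hr => ?_⟩
  have hl : 0 ≤ Real.log r := Real.log_nonneg hr
  -- The critical exponent is perturbed to `N + δ`. This choice keeps `r^δ ≤ e`, while the constant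
  -- `V/δ` of the supercritical bound becomes `V (1 + log r)`.
  set δ : ℝ := 1 / (1 + Real.log r) with hδ
  have hδ0 : 0 < δ := by positivity
  have hrδ : r ^ δ ≤ Real.exp 1 := by
    rw [Real.rpow_def_of_pos (by linarith), Real.exp_le_exp, hδ, mul_one_div, div_le_one (by linarith)]
    linarith
  calc barrierMass N N r ≤ Real.exp 1 * barrierMass N (N + δ) r := by
        rw [barrierMass, barrierMass, ← integral_const_mul]
        refine integral_mono (integrable_barrier_ball hNp r)
          ((integrable_barrier_ball (by linarith) r).const_mul _) fun y => ?_
        simp only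
        split_ifs with h
        · rcases le_or_gt ‖y‖ 1 with h1 | h1
          · rw [barrier, if_pos h1, barrier, if_pos h1, mul_one]
            exact Real.one_le_exp zero_le_one
          · have hy : 0 < ‖y‖ := by linarith
            rw [barrier_eq_rpow h1.le, barrier_eq_rpow h1.le,
              show -(N : ℝ) = δ + -(N + δ) by ring, Real.rpow_add hy]
            gcongr
            exact (Real.rpow_le_rpow hy.le h hδ0.le).trans hrδ
        · simp
    _ ≤ Real.exp 1 * (v + V / ((N + δ) - N)) := by
        gcongr
        exact barrierMass_le_of_gt hN (by linarith) r
    _ = Real.exp 1 * (v + V * (1 + Real.log r)) := by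
        rw [add_sub_cancel_left, hδ, div_div_eq_mul_div, div_one]
    _ ≤ Real.exp 1 * (v + V) * (1 + Real.log r) := by
        rw [mul_assoc (Real.exp 1)]
        refine mul_le_mul_of_nonneg_left ?_ (Real.exp_pos 1).le
        nlinarith

/-- Exhaustion by balls: global integrability of `ρ φ |u|^p` is not assumed but comes out of the
uniform estimate. -/
theorem integrable_of_forall_closedBall {f : Eucl N → ℝ} {A : ℝ} (hf0 : ∀ x, 0 ≤ f x)
    (hf : ∀ r : ℝ, IntegrableOn f (Metric.closedBall 0 r))
    (hA : ∀ r : ℝ, 1 ≤ r → ∫ x in Metric.closedBall (0 : Eucl N) r, f x ≤ A) :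
    Integrable f ∧ ∫ x, f x ≤ A := by
  have hcov : AECover (volume : Measure (Eucl N)) atTop
      (fun n : ℕ => Metric.closedBall (0 : Eucl N) ((n : ℝ) + 1)) :=
    aecover_closedBall (tendsto_natCast_atTop_atTop.atTop_add tendsto_const_nhds)
  have hA' : ∀ n : ℕ, ∫ x in Metric.closedBall (0 : Eucl N) ((n : ℝ) + 1), f x ≤ A := fun n =>
    hA _ (by linarith [Nat.cast_nonneg (α := ℝ) n])
  have hi : Integrable f := hcov.integrable_of_integral_bounded_of_nonneg_ae A
    (fun n => hf _) (Eventually.of_forall hf0) (Eventually.of_forall hA')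
  exact ⟨hi, le_of_tendsto' (hcov.integral_tendsto_of_countably_generated hi) hA'⟩

/-! ### From the tested inequality to uniqueness -/

section Uniqueness

variable {s p : ℝ} {ρ c u : Eucl N → ℝ}

theorem integrableOn_density_barrier (hρ : Continuous ρ) (hp : 0 ≤ p) (hu : Continuous u)
    {β : ℝ} (hβ : 0 < β) (r : ℝ) :
    IntegrableOn (fun x => ρ x * barrier β x * |u x| ^ p) (Metric.closedBall 0 r) := by
  have h1 : Continuous (fun x => ρ x * |u x| ^ p) :=
    hρ.mul (hu.abs.rpow_const fun x => Or.inr hp)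
  have h2 := (h1.continuousOn (s := Metric.closedBall 0 r)).integrableOn_compact
    (μ := volume) (isCompact_closedBall 0 r)
  refine (h2.bdd_mul (c := 1) (measurable_barrier β).aestronglyMeasurable.restrict
    (Eventually.of_forall fun x => ?_)).congr (Eventually.of_forall fun x => ?_)
  · rw [Real.norm_of_nonneg (barrier_pos β x).le]; exact barrier_le_one hβ x
  · simp only; ring

theorem IsSolution.integral_closedBall_le (hN : 1 ≤ N) (hs₀ : 0 < s) (hs₁ : s < 1) (hp : 1 ≤ p)
    {c₀ : ℝ} (hρ : IsDensity ρ) (hc : Continuous c) (hc₀ : 0 < c₀) (hcc : ∀ x, c₀ ≤ c x)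
    (hsol : IsSolution s ρ c u) (hv : MemLs s (fun x => |u x| ^ p)) {β R r : ℝ} {b : Eucl N → ℝ}
    (hβ : 0 < β) (hR : 2 ≤ R) (hr : r ≤ R / 2)
    (hb : ∀ ε, 0 < ε → ∀ x, -truncFL ((N : ℝ) + 2 * s) ε (testFun β R) x ≤ b x)
    (hvb : Integrable (fun x => |u x| ^ p * b x)) :
    p * c₀ * ∫ x in Metric.closedBall (0 : Eucl N) r, ρ x * barrier β x * |u x| ^ p ≤
      fracConst N s * ∫ x, |u x| ^ p * b x := by
  have hucont := hsol.regular.continuous hs₀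
  have h := hsol.integral_test_le hN hs₀ hs₁ hp hv (M := 1) (R := R) (by linarith)
    (measurable_testFun β R) (testFun_nonneg β R) (testFun_le_one hβ R)
    (fun x hx => testFun_eq_zero (by linarith) hx) hb hvb
  refine le_trans ?_ h
  rw [mul_assoc]
  refine mul_le_mul_of_nonneg_left ?_ (by linarith)
  have hp0 : 0 ≤ p := by linarith
  have hloc := integrableOn_density_barrier hρ.1 hp0 hucont hβ r
  rw [← integral_const_mul, ← integral_indicator Metric.isClosed_closedBall.measurableSet]
  have hnn : ∀ x, 0 ≤ ρ x * c x * |u x| ^ p := fun x => by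
    have := (hρ.2 x).le
    have := hc₀.le.trans (hcc x)
    positivity
  refine integral_mono ((integrable_indicator_iff Metric.isClosed_closedBall.measurableSet).2
    (hloc.const_mul c₀)) ?_ fun x => ?_
  · have hcont : Continuous (fun x => ρ x * c x * |u x| ^ p) :=
      (hρ.1.mul hc).mul (hucont.abs.rpow_const fun x => Or.inr hp0)
    obtain ⟨M, hM⟩ := (isCompact_closedBall (0 : Eucl N) R).exists_bound_of_continuousOn
      hcont.continuousOn
    refine integrable_of_bounded_of_support (R := R) (M := 1 * M)
      ((measurable_testFun β R).mul hcont.measurable) (fun x hx => ?_) fun x hx => ?_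
    · rw [abs_mul, abs_of_nonneg (testFun_nonneg β R x)]
      exact mul_le_mul (testFun_le_one hβ R x) (hM x (by simpa using hx)) (abs_nonneg _) zero_le_one
    · rw [testFun_eq_zero (by linarith) hx, zero_mul]
  · by_cases hx : x ∈ Metric.closedBall (0 : Eucl N) r
    · rw [Set.indicator_of_mem hx]
      rw [mem_closedBall_zero_iff] at hx
      simp only
      rw [testFun_eq_barrier (by linarith) (hx.trans hr)]
      have h1 := (hρ.2 x).le
      have h2 := (barrier_pos β x).le
      have h3 : 0 ≤ |u x| ^ p := by positivity
      calc c₀ * (ρ x * barrier β x * |u x| ^ p) ≤ c x * (ρ x * barrier β x * |u x| ^ p) :=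
            mul_le_mul_of_nonneg_right (hcc x) (by positivity)
        _ = _ := by ring
    · rw [Set.indicator_of_notMem hx]
      exact mul_nonneg (testFun_nonneg β R x) (hnn x)

theorem eq_zero_of_integral_nonpos (hρ : IsDensity ρ) (hp : 1 ≤ p) (hu : Continuous u) {β : ℝ}
    (hi : Integrable (fun x => ρ x * barrier β x * |u x| ^ p))
    (hle : ∫ x, ρ x * barrier β x * |u x| ^ p ≤ 0) (x : Eucl N) : u x = 0 := by
  have hnn : ∀ x, 0 ≤ ρ x * barrier β x * |u x| ^ p := fun x => by
    have := (hρ.2 x).le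
    have := (barrier_pos β x).le
    positivity
  have h0 : ∫ x, ρ x * barrier β x * |u x| ^ p = 0 := le_antisymm hle (integral_nonneg hnn)
  rw [integral_eq_zero_iff_of_nonneg hnn hi] at h0
  have hae : u =ᵐ[volume] fun _ => 0 := by
    filter_upwards [h0] with y hy
    have h1 := (hρ.2 y).ne'
    have h2 := (barrier_pos β y).ne'
    have h3 : |u y| ^ p = 0 := by
      simpa [h1, h2] using hy
    rw [Real.rpow_eq_zero (abs_nonneg _) (by linarith)] at h3
    exact abs_eq_zero.1 h3
  exact congrFun ((hu.ae_eq_iff_eq volume continuous_const).1 hae) x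

/-- Uniqueness when the truncated fractional Laplacians of the test functions are bounded below
by `-D B` and the zeroth order term dominates. -/
theorem IsSolution.eq_zero_of_dominated (hN : 1 ≤ N) (hs₀ : 0 < s) (hs₁ : s < 1) (hp : 1 ≤ p)
    {c₀ : ℝ} (hρ : IsDensity ρ) (hc : Continuous c) (hc₀ : 0 < c₀) (hcc : ∀ x, c₀ ≤ c x)
    (hsol : IsSolution s ρ c u) (hv : MemLs s (fun x => |u x| ^ p)) {β D κ : ℝ} {B : Eucl N → ℝ}
    (hβ : 0 < β) (hD0 : 0 ≤ D) (hκ : 0 < κ)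
    (hD : ∀ R ε, 2 ≤ R → 0 < ε → ∀ x : Eucl N, 1 ≤ ‖x‖ →
      -truncFL ((N : ℝ) + 2 * s) ε (testFun β R) x ≤ D * B x)
    (hρB : ∀ x, 1 ≤ ‖x‖ → κ * B x ≤ ρ x * barrier β x)
    (hB : Integrable (fun x => |u x| ^ p * (if 1 ≤ ‖x‖ then B x else 0)))
    (hlarge : fracConst N s * D < p * c₀ * κ) (x : Eucl N) : u x = 0 := by
  have hucont := hsol.regular.continuous hs₀
  have hC := fracConst_pos N hs₀ hs₁
  have hp0 : 0 < p := by linarith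
  set f : Eucl N → ℝ := fun x => ρ x * barrier β x * |u x| ^ p with hf
  set T : ℝ := ∫ x, |u x| ^ p * (if 1 ≤ ‖x‖ then B x else 0) with hT
  have hf0 : ∀ x, 0 ≤ f x := fun x => by
    have := (hρ.2 x).le
    have := (barrier_pos β x).le
    simp only [hf]; positivity
  have hball : ∀ r : ℝ, 1 ≤ r → ∫ x in Metric.closedBall (0 : Eucl N) r, f x ≤
      fracConst N s * (D * T) / (p * c₀) := by
    intro r hr
    rw [le_div_iff₀ (by positivity), mul_comm]
    have e : ∀ x : Eucl N, |u x| ^ p * (if 1 ≤ ‖x‖ then D * B x else 0) =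
        D * (|u x| ^ p * (if 1 ≤ ‖x‖ then B x else 0)) := fun x => by split_ifs <;> ring
    -- With `R = 2r` the test function equals the barrier on the ball of radius `r`.
    have := hsol.integral_closedBall_le hN hs₀ hs₁ hp hρ hc hc₀ hcc hv (β := β) (R := 2 * r)
      (r := r) (b := fun x => if 1 ≤ ‖x‖ then D * B x else 0) hβ (by linarith) (by linarith)
      (fun ε hε x => by
        split_ifs with h
        · exact hD _ ε (by linarith) hε x h
        · linarith [truncFL_testFun_nonneg (q := (N : ℝ) + 2 * s) (ε := ε) hβ (2 * r)
            (not_le.1 h).le])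
      (by simp only [e]; exact hB.const_mul D)
    simpa only [e, integral_const_mul] using this
  obtain ⟨hi, hle⟩ := integrable_of_forall_closedBall hf0
    (fun r => integrableOn_density_barrier hρ.1 hp0.le hucont hβ r) hball
  have hTf : κ * T ≤ ∫ x, f x := by
    rw [hT, ← integral_const_mul]
    refine integral_mono (hB.const_mul κ) hi fun x => ?_
    simp only
    split_ifs with h
    · have h1 := hρB x h
      have h2 : 0 ≤ |u x| ^ p := by positivity
      calc κ * (|u x| ^ p * B x) = κ * B x * |u x| ^ p := by ring
        _ ≤ _ := mul_le_mul_of_nonneg_right h1 h2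
    · rw [mul_zero, mul_zero]; exact hf0 x
  refine eq_zero_of_integral_nonpos hρ hp hucont hi ?_ x
  rw [le_div_iff₀ (by positivity)] at hle
  by_contra hpos
  rw [not_le] at hpos
  -- If `I = ∫ f > 0`, then `κ p c₀ I ≤ C_{N,s} D κ T ≤ C_{N,s} D I` contradicts `hlarge`.
  -- Finiteness of `T` and `I`, established above, is essential.
  have h1 : κ * ((∫ x, f x) * (p * c₀)) ≤ fracConst N s * D * ∫ x, f x :=
    calc κ * ((∫ x, f x) * (p * c₀)) ≤ κ * (fracConst N s * (D * T)) := by gcongr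
      _ = fracConst N s * D * (κ * T) := by ring
      _ ≤ _ := by gcongr
  nlinarith

theorem MemLpWeight.integrable_of_le {β C : ℝ} (hu : MemLpWeight β p u) (hβ : 0 ≤ β)
    {B : Eucl N → ℝ} (hBm : Measurable B) (hB0 : ∀ x, 1 ≤ ‖x‖ → 0 ≤ B x)
    (hBC : ∀ x, 1 ≤ ‖x‖ → B x ≤ C * ‖x‖ ^ (-β)) (hC : 0 ≤ C) :
    Integrable (fun x => |u x| ^ p * (if 1 ≤ ‖x‖ then B x else 0)) := by
  -- The factor `2^{β/2}` comes from `1 + |x|² ≤ 2|x|²` for `|x| ≥ 1`.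
  refine (hu.2.const_mul (C * 2 ^ (β / 2))).mono' ?_ (Eventually.of_forall fun x => ?_)
  · exact ((hu.1.abs.pow_const p).mul (Measurable.ite (measurableSet_le measurable_const
      measurable_norm) hBm measurable_const).aemeasurable).aestronglyMeasurable
  · have h0 : 0 ≤ |u x| ^ p := by positivity
    have hw : 0 ≤ weight β x := by unfold weight; positivity
    split_ifs with h
    · have hx : 0 < ‖x‖ := by linarith
      rw [Real.norm_of_nonneg (mul_nonneg h0 (hB0 x h))]
      have h1 : ‖x‖ ^ (-β) ≤ 2 ^ (β / 2) * weight β x := by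
        have e1 : ‖x‖ ^ (-β) = 2 ^ (β / 2) * (2 * ‖x‖ ^ 2) ^ (-β / 2) := by
          rw [Real.mul_rpow (by norm_num) (by positivity), ← mul_assoc,
            ← Real.rpow_add (by norm_num), ← Real.rpow_natCast, ← Real.rpow_mul hx.le]
          rw [show β / 2 + -β / 2 = 0 by ring, Real.rpow_zero, one_mul]
          congr 1
          push_cast; ring
        rw [e1]
        refine mul_le_mul_of_nonneg_left ?_ (by positivity)
        exact Real.rpow_le_rpow_of_nonpos (by positivity) (by nlinarith) (by linarith)
      calc |u x| ^ p * B x ≤ |u x| ^ p * (C * (2 ^ (β / 2) * weight β x)) := by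
            gcongr
            exact (hBC x h).trans (by gcongr)
        _ = _ := by ring
    · rw [mul_zero, norm_zero]; positivity

end Uniqueness

/-! ### Decay rates for the three ranges of the exponent, and the subcritical case -/

theorem exists_truncFL_testFun_le_of_lt (hN : 1 ≤ N) {s β : ℝ} (hs₀ : 0 < s) (hs₁ : s < 1)
    (hβ : 0 < β) (hβN : β < N) :
    ∃ D : ℝ, 0 ≤ D ∧ ∀ R ε, 2 ≤ R → 0 < ε → ∀ x : Eucl N, 1 ≤ ‖x‖ →
      -truncFL ((N : ℝ) + 2 * s) ε (testFun β R) x ≤ D * ‖x‖ ^ (-β - 2 * s) := by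
  obtain ⟨C, hC, h⟩ := exists_bound_truncFL_testFun hN hs₀ hs₁ hβ
  obtain ⟨C', hC', h'⟩ := exists_barrierMass_le_of_lt hN hβ hβN
  refine ⟨C * (1 + C'), by positivity, fun R ε hR hε x hx => (h R ε hR hε x hx).trans ?_⟩
  have hx0 : 0 < ‖x‖ := by linarith
  rw [mul_assoc]
  refine mul_le_mul_of_nonneg_left ?_ hC
  calc _ ≤ ‖x‖ ^ (-β - 2 * s) + ‖x‖ ^ (-((N : ℝ) + 2 * s)) * (C' * ‖x‖ ^ ((N : ℝ) - β)) := by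
        gcongr; exact h' _ hx
    _ = _ := by
        rw [show -β - 2 * s = -((N : ℝ) + 2 * s) + ((N : ℝ) - β) by ring, Real.rpow_add hx0]
        ring

theorem exists_truncFL_testFun_le_log (hN : 1 ≤ N) {s : ℝ} (hs₀ : 0 < s) (hs₁ : s < 1) :
    ∃ D : ℝ, 0 ≤ D ∧ ∀ R ε, 2 ≤ R → 0 < ε → ∀ x : Eucl N, 1 ≤ ‖x‖ →
      -truncFL ((N : ℝ) + 2 * s) ε (testFun N R) x ≤
        D * (‖x‖ ^ (-((N : ℝ) + 2 * s)) * (1 + Real.log ‖x‖)) := by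
  have hNp : (0 : ℝ) < N := by exact_mod_cast hN
  obtain ⟨C, hC, h⟩ := exists_bound_truncFL_testFun hN hs₀ hs₁ hNp
  obtain ⟨C', hC', h'⟩ := exists_barrierMass_le_log hN
  refine ⟨C * (1 + C'), by positivity, fun R ε hR hε x hx => (h R ε hR hε x hx).trans ?_⟩
  have hl := Real.log_nonneg hx
  rw [mul_assoc]
  refine mul_le_mul_of_nonneg_left ?_ hC
  rw [show -(N : ℝ) - 2 * s = -((N : ℝ) + 2 * s) by ring]
  have hpos : 0 ≤ ‖x‖ ^ (-((N : ℝ) + 2 * s)) := by positivity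
  calc _ ≤ ‖x‖ ^ (-((N : ℝ) + 2 * s)) +
        ‖x‖ ^ (-((N : ℝ) + 2 * s)) * (C' * (1 + Real.log ‖x‖)) := by
        gcongr; exact h' _ hx
    _ ≤ _ := by nlinarith [mul_nonneg hpos hl]

theorem exists_truncFL_testFun_le_of_gt (hN : 1 ≤ N) {s β : ℝ} (hs₀ : 0 < s) (hs₁ : s < 1)
    (hβN : (N : ℝ) < β) :
    ∃ D : ℝ, 0 ≤ D ∧ ∀ R ε, 2 ≤ R → 0 < ε → ∀ x : Eucl N, 1 ≤ ‖x‖ →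
      -truncFL ((N : ℝ) + 2 * s) ε (testFun β R) x ≤ D * ‖x‖ ^ (-((N : ℝ) + 2 * s)) := by
  have hβ : 0 < β := (Nat.cast_nonneg N).trans_lt hβN
  obtain ⟨C, hC, h⟩ := exists_bound_truncFL_testFun hN hs₀ hs₁ hβ
  set C' := volume.real (Metric.closedBall (0 : Eucl N) 1) +
      N * volume.real (Metric.ball (0 : Eucl N) 1) / (β - N) with hC'def
  have hC' : 0 ≤ C' := by
    have : 0 < β - N := by linarith
    positivity
  refine ⟨C * (1 + C'), by positivity, fun R ε hR hε x hx => (h R ε hR hε x hx).trans ?_⟩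
  rw [mul_assoc]
  refine mul_le_mul_of_nonneg_left ?_ hC
  calc _ ≤ ‖x‖ ^ (-((N : ℝ) + 2 * s)) + ‖x‖ ^ (-((N : ℝ) + 2 * s)) * C' := by
        gcongr
        · linarith
        · exact barrierMass_le_of_gt hN hβN _
    _ = _ := by ring

theorem uniquenessHolds_of_le (hN : 1 ≤ N) {s β p c₀ : ℝ} (hs₀ : 0 < s) (hs₁ : s < 1) (hβ : 0 < β)
    (hβN : β ≤ N - 2 * s) (hp : 1 ≤ p) (hc₀ : 0 < c₀) {ρ : Eucl N → ℝ} (hρ : IsDensity ρ) :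
    UniquenessHolds s β p c₀ ρ := by
  intro c hc _ hcc u hsol hv hu
  have hNs : 2 * s < N := by linarith
  have hγ : 0 < (N : ℝ) - 2 * s := by linarith
  have hq : (N : ℝ) < N + 2 * s := by linarith
  have hp0 : 0 < p := by linarith
  have hucont := hsol.regular.continuous hs₀
  obtain ⟨D, hD0, hD⟩ := exists_truncFL_testFun_le_of_lt hN hs₀ hs₁ hγ (by linarith)
  have hB : Integrable (fun x => |u x| ^ p * (if 1 ≤ ‖x‖ then
      D * ‖x‖ ^ (-((N : ℝ) - 2 * s) - 2 * s) else 0)) :=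
    hu.integrable_of_le (C := D) hβ.le (measurable_const.mul (measurable_norm.pow_const _))
      (fun x _ => by positivity) (fun x hx => by
        gcongr
        linarith) hD0
  have hball : ∀ r : ℝ, 1 ≤ r → ∫ x in Metric.closedBall (0 : Eucl N) r,
      ρ x * barrier (N - 2 * s) x * |u x| ^ p ≤ 0 := by
    intro r hr
    -- The test function is cut off at `2(r + n)`, so superharmonicity disposes of `|x| ≤ r + n`.
    -- The rate outside is `|x|^{-N}`, and these exterior integrals tend to zero as `n → ∞`.
    set F : ℕ → Eucl N → ℝ := fun n x => |u x| ^ p * (if r + n < ‖x‖ then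
      D * ‖x‖ ^ (-((N : ℝ) - 2 * s) - 2 * s) else 0) with hF
    have hFm : ∀ n, AEStronglyMeasurable (F n) := fun n =>
      ((hucont.measurable.abs.pow_const p).mul (Measurable.ite (measurableSet_lt measurable_const
        measurable_norm) (measurable_const.mul (measurable_norm.pow_const _))
          measurable_const)).aestronglyMeasurable
    have hFb : ∀ n, ∀ x, ‖F n x‖ ≤ |u x| ^ p * (if 1 ≤ ‖x‖ then
        D * ‖x‖ ^ (-((N : ℝ) - 2 * s) - 2 * s) else 0) := by
      intro n x
      have hn : (0 : ℝ) ≤ n := Nat.cast_nonneg n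
      simp only [hF]
      by_cases h : r + n < ‖x‖
      · rw [if_pos h, if_pos (by linarith), Real.norm_of_nonneg (by positivity)]
      · rw [if_neg h, mul_zero, norm_zero]
        split_ifs <;> positivity
    have hlim := tendsto_integral_of_dominated_convergence _ hFm hB
      (fun n => Eventually.of_forall (hFb n)) (f := fun _ => 0) (Eventually.of_forall fun x => by
        refine tendsto_const_nhds.congr' ?_
        filter_upwards [eventually_ge_atTop ⌈‖x‖⌉₊] with n hn
        have : ‖x‖ ≤ n := Nat.ceil_le.1 hn
        simp only [hF]
        rw [if_neg (by linarith), mul_zero])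
    rw [integral_zero] at hlim
    have hle : ∀ n : ℕ, p * c₀ * ∫ x in Metric.closedBall (0 : Eucl N) r,
        ρ x * barrier (N - 2 * s) x * |u x| ^ p ≤ fracConst N s * ∫ x, F n x := by
      intro n
      have hn : (0 : ℝ) ≤ n := Nat.cast_nonneg n
      refine hsol.integral_closedBall_le hN hs₀ hs₁ hp hρ hc hc₀ hcc hv (R := 2 * (r + n))
        hγ (by linarith) (by linarith) (fun ε hε x => ?_) (hB.mono' (hFm n)
          (Eventually.of_forall (hFb n)))
      split_ifs with h
      · exact hD _ ε (by linarith) hε x (by linarith)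
      · linarith [truncFL_barrier_nonneg hN hs₀ hNs hε x, truncFL_barrier_le hq hε hγ
          (R := 2 * (r + n)) (by linarith) (x := x) (by linarith)]
    have hfin := ge_of_tendsto' (hlim.const_mul (fracConst N s)) hle
    rw [mul_zero] at hfin
    by_contra hpos
    rw [not_le] at hpos
    have : 0 < p * c₀ := by positivity
    nlinarith [mul_pos this hpos]
  obtain ⟨hi, hle⟩ := integrable_of_forall_closedBall (fun x => by
    have := (hρ.2 x).le
    have := (barrier_pos ((N : ℝ) - 2 * s) x).le
    positivity) (fun r => integrableOn_density_barrier hρ.1 hp0.le hucont hγ r) hball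
  exact eq_zero_of_integral_nonpos hρ hp hucont hi hle

/-! ### Comparison of the density bounds with the decay rates -/

theorem rpow_le_one_add_sq_rpow {α r : ℝ} (hr : 1 ≤ r) :
    2 ^ (-|α| / 2) * r ^ (-α) ≤ (1 + r ^ 2) ^ (-α / 2) := by
  have hr0 : 0 < r := by linarith
  have e : r ^ (-α) = (r ^ 2) ^ (-α / 2) := by
    rw [← Real.rpow_natCast, ← Real.rpow_mul hr0.le]
    congr 1
    push_cast; ring
  rw [e]
  rcases le_total 0 α with h | h
  · rw [abs_of_nonneg h, ← Real.mul_rpow (by norm_num) (by positivity)]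
    exact Real.rpow_le_rpow_of_nonpos (by positivity) (by nlinarith) (by linarith)
  · calc 2 ^ (-|α| / 2) * (r ^ 2) ^ (-α / 2) ≤ 1 * (r ^ 2) ^ (-α / 2) := by
          gcongr
          exact Real.rpow_le_one_of_one_le_of_nonpos (by norm_num)
            (by linarith [abs_nonneg α])
      _ ≤ _ := by
          rw [one_mul]
          exact Real.rpow_le_rpow (by positivity) (by linarith) (by linarith)

theorem PowerLowerBound.le_density_mul_barrier {α β K : ℝ} (hK : 0 < K) {ρ : Eucl N → ℝ}
    (h : PowerLowerBound α K ρ) {x : Eucl N} (hx : 1 ≤ ‖x‖) :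
    K * 2 ^ (-|α| / 2) * ‖x‖ ^ (-α - β) ≤ ρ x * barrier β x := by
  have hx0 : 0 < ‖x‖ := by linarith
  rw [barrier_eq_rpow hx, sub_eq_add_neg, Real.rpow_add hx0, ← mul_assoc]
  refine mul_le_mul_of_nonneg_right ?_ (by positivity)
  refine le_trans ?_ (h x)
  rw [mul_assoc]
  exact mul_le_mul_of_nonneg_left (rpow_le_one_add_sq_rpow hx) hK.le

theorem one_add_log_le {δ r : ℝ} (hδ : 0 < δ) (hr : 1 ≤ r) :
    1 + Real.log r ≤ (1 + 1 / δ) * r ^ δ := by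
  have h1 := Real.log_le_rpow_div (by linarith : 0 ≤ r) hδ
  have h2 : 1 ≤ r ^ δ := Real.one_le_rpow hr hδ.le
  rw [add_mul, one_mul, one_div_mul_eq_div]
  linarith

/-- Weights `4/5` and `1/5` on the lower bounds `log 2` and `2 log r` suffice, since `(4/5) log 2 >
2/5`. -/
theorem one_add_log_le_log_one_add_sq {r : ℝ} (hr : 1 ≤ r) :
    2 / 5 * (1 + Real.log r) ≤ Real.log (1 + r ^ 2) := by
  have h1 : Real.log 2 ≤ Real.log (1 + r ^ 2) := Real.log_le_log (by norm_num) (by nlinarith)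
  have h2 : 2 * Real.log r ≤ Real.log (1 + r ^ 2) := by
    have := Real.log_le_log (by positivity : 0 < r ^ 2) (by linarith : r ^ 2 ≤ 1 + r ^ 2)
    rwa [Real.log_pow, Nat.cast_ofNat] at this
  have := Real.log_two_gt_d9
  linarith

theorem MemLs.integrable_exterior {s : ℝ} {g : Eucl N → ℝ} (h : MemLs s g) (hs : 0 < s) :
    Integrable (fun x => g x * (if 1 ≤ ‖x‖ then ‖x‖ ^ (-((N : ℝ) + 2 * s)) else 0)) := by
  refine (h.2.const_mul 2).mono' (h.1.mul (Measurable.ite (measurableSet_le measurable_const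
      measurable_norm) (measurable_norm.pow_const _)
        measurable_const).aemeasurable).aestronglyMeasurable (Eventually.of_forall fun x => ?_)
  split_ifs with hx
  · have hx0 : 0 < ‖x‖ := by linarith
    have h1 : 1 ≤ ‖x‖ ^ ((N : ℝ) + 2 * s) := Real.one_le_rpow hx (by positivity)
    rw [norm_mul, Real.norm_eq_abs, Real.norm_of_nonneg (by positivity), Real.rpow_neg hx0.le,
      ← mul_div_assoc, ← div_eq_mul_inv, div_le_div_iff₀ (by positivity) (by positivity)]
    nlinarith [abs_nonneg (g x)]
  · rw [mul_zero, norm_zero]; positivity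

theorem integrable_log_weight {s p : ℝ} {u : Eucl N → ℝ} (hs : 0 < s) (hu : MemLpWeight N p u) :
    Integrable (fun x => |u x| ^ p * (if 1 ≤ ‖x‖ then
      ‖x‖ ^ (-((N : ℝ) + 2 * s)) * (1 + Real.log ‖x‖) else 0)) := by
  refine hu.integrable_of_le (C := 1 + 1 / (2 * s)) (Nat.cast_nonneg N)
    ((measurable_norm.pow_const _).mul (measurable_const.add measurable_norm.log))
    (fun x hx => ?_) (fun x hx => ?_) (by positivity)
  · have := Real.log_nonneg hx
    positivity
  · have hx0 : 0 < ‖x‖ := by linarith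
    calc _ ≤ ‖x‖ ^ (-((N : ℝ) + 2 * s)) * ((1 + 1 / (2 * s)) * ‖x‖ ^ (2 * s)) := by
          gcongr; exact one_add_log_le (by positivity) hx
      _ = _ := by
          rw [show -(N : ℝ) = -((N : ℝ) + 2 * s) + 2 * s by ring, Real.rpow_add hx0]
          ring

theorem lt_of_threshold_le {A κ p c₀ K : ℝ} (hκ : 0 < κ) (h : A / κ + 1 ≤ p * c₀ * K) :
    A < p * c₀ * (K * κ) := by
  have h1 : A / κ < p * c₀ * K := by linarith
  rw [div_lt_iff₀ hκ] at h1
  linarith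

end FracElliptic

/-! ### Assembling the cases -/

theorem theorem2p8 (N : ℕ) (hN : 1 ≤ N) (s : ℝ) (hs₀ : 0 < s) (hs₁ : s < 1)
    (β : ℝ) (hβ : 0 < β) :
    -- case (i): no largeness condition
    (β ≤ N - 2 * s →
      ∀ α p c₀ K : ℝ, 1 ≤ p → 0 < c₀ → 0 < K →
        ∀ ρ : EuclideanSpace ℝ (Fin N) → ℝ,
          FracElliptic.IsDensity ρ → FracElliptic.PowerLowerBound α K ρ →
          FracElliptic.UniquenessHolds s β p c₀ ρ) ∧
    -- cases (ii), (iii) (first alternative), (iv): the threshold depends only on `N, s, α, β`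
    (∀ α : ℝ,
      (((N : ℝ) - 2 * s < β ∧ β < N ∧ α ≤ 2 * s) ∨
        (β = N ∧ α < 2 * s) ∨
        ((N : ℝ) < β ∧ α + β ≤ 2 * s + N)) →
      ∃ Λ : ℝ, ∀ p c₀ K : ℝ, 1 ≤ p → 0 < c₀ → 0 < K → Λ ≤ p * c₀ * K →
        ∀ ρ : EuclideanSpace ℝ (Fin N) → ℝ,
          FracElliptic.IsDensity ρ → FracElliptic.PowerLowerBound α K ρ →
          FracElliptic.UniquenessHolds s β p c₀ ρ) ∧
    -- case (iii), second alternative: the threshold depends only on `N, s`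
    (β = N →
      ∃ Λ : ℝ, ∀ p c₀ K : ℝ, 1 ≤ p → 0 < c₀ → 0 < K → Λ ≤ p * c₀ * K →
        ∀ ρ : EuclideanSpace ℝ (Fin N) → ℝ,
          FracElliptic.IsDensity ρ → FracElliptic.LogLowerBound s K ρ →
          FracElliptic.UniquenessHolds s β p c₀ ρ) := by
  open FracElliptic MeasureTheory in
  refine ⟨fun hβN α p c₀ K hp hc₀ _ ρ hρ _ =>
    uniquenessHolds_of_le hN hs₀ hs₁ hβ hβN hp hc₀ hρ, fun α hα => ?_, fun hβN => ?_⟩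
  · have hκ : (0 : ℝ) < 2 ^ (-|α| / 2) := by positivity
    rcases hα with ⟨-, hβN, hα⟩ | ⟨rfl, hα⟩ | ⟨hβN, hα⟩
    · obtain ⟨D, hD0, hD⟩ := exists_truncFL_testFun_le_of_lt hN hs₀ hs₁ hβ hβN
      -- The summand `1` in the threshold makes the required domination strict.
      refine ⟨fracConst N s * D / 2 ^ (-|α| / 2) + 1, ?_⟩
      intro p c₀ K hp hc₀ hK hΛ ρ hρ hρK c hc _ hcc u hsol hv hu
      refine hsol.eq_zero_of_dominated hN hs₀ hs₁ hp hρ hc hc₀ hcc hv hβ hD0 (mul_pos hK hκ) hD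
        (fun x hx => ?_) ?_ (lt_of_threshold_le hκ hΛ)
      · refine le_trans ?_ (hρK.le_density_mul_barrier hK hx)
        exact mul_le_mul_of_nonneg_left (Real.rpow_le_rpow_of_exponent_le hx (by linarith))
          (by positivity)
      · refine hu.integrable_of_le (C := 1) hβ.le (measurable_norm.pow_const _)
          (fun x _ => by positivity) (fun x hx => ?_) zero_le_one
        rw [one_mul]
        exact Real.rpow_le_rpow_of_exponent_le hx (by linarith)
    · obtain ⟨D, hD0, hD⟩ := exists_truncFL_testFun_le_log hN hs₀ hs₁
      -- The strict gap `2s - α` supplies a power of `|x|` that absorbs the logarithm, at the cost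
      -- of the factor `1 + 1/(2s - α)` in `κ`.
      have hδ : 0 < 2 * s - α := by linarith
      have hκ' : 0 < 2 ^ (-|α| / 2) / (1 + 1 / (2 * s - α)) := by positivity
      refine ⟨fracConst N s * D / (2 ^ (-|α| / 2) / (1 + 1 / (2 * s - α))) + 1, ?_⟩
      intro p c₀ K hp hc₀ hK hΛ ρ hρ hρK c hc _ hcc u hsol hv hu
      refine hsol.eq_zero_of_dominated hN hs₀ hs₁ hp hρ hc hc₀ hcc hv hβ hD0 (mul_pos hK hκ') hD
        (fun x hx => ?_) (integrable_log_weight hs₀ hu) (lt_of_threshold_le hκ' hΛ)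
      have hx0 : 0 < ‖x‖ := by linarith
      refine le_trans ?_ (hρK.le_density_mul_barrier hK hx)
      calc _ ≤ K * (2 ^ (-|α| / 2) / (1 + 1 / (2 * s - α))) * (‖x‖ ^ (-((N : ℝ) + 2 * s)) *
            ((1 + 1 / (2 * s - α)) * ‖x‖ ^ (2 * s - α))) := by
            gcongr; exact one_add_log_le hδ hx
        _ = _ := by
            rw [show -α - (N : ℝ) = -((N : ℝ) + 2 * s) + (2 * s - α) by ring, Real.rpow_add hx0]
            field_simp
    · obtain ⟨D, hD0, hD⟩ := exists_truncFL_testFun_le_of_gt hN hs₀ hs₁ hβN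
      refine ⟨fracConst N s * D / 2 ^ (-|α| / 2) + 1, ?_⟩
      intro p c₀ K hp hc₀ hK hΛ ρ hρ hρK c hc _ hcc u hsol hv hu
      -- Here the rate is `|x|^{-N-2s}`, so its integrability comes from `|u|^p ∈ 𝓛^s`; the weighted
      -- hypothesis would not give it when `β > N + 2s`.
      refine hsol.eq_zero_of_dominated hN hs₀ hs₁ hp hρ hc hc₀ hcc hv hβ hD0 (mul_pos hK hκ) hD
        (fun x hx => ?_) (hv.integrable_exterior hs₀) (lt_of_threshold_le hκ hΛ)
      refine le_trans ?_ (hρK.le_density_mul_barrier hK hx)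
      exact mul_le_mul_of_nonneg_left (Real.rpow_le_rpow_of_exponent_le hx (by linarith))
        (by positivity)
  · subst hβN
    obtain ⟨D, hD0, hD⟩ := exists_truncFL_testFun_le_log hN hs₀ hs₁
    -- One factor compares `(1 + |x|²)^{-s}` with `|x|^{-2s}`, and `2/5` compares `log(1 + |x|²)`
    -- with `1 + log |x|`.
    have hκ : (0 : ℝ) < 2 ^ (-|2 * s| / 2) * (2 / 5) := by positivity
    refine ⟨fracConst N s * D / (2 ^ (-|2 * s| / 2) * (2 / 5)) + 1, ?_⟩
    intro p c₀ K hp hc₀ hK hΛ ρ hρ hρK c hc _ hcc u hsol hv hu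
    refine hsol.eq_zero_of_dominated hN hs₀ hs₁ hp hρ hc hc₀ hcc hv hβ hD0 (mul_pos hK hκ) hD
      (fun x hx => ?_) (integrable_log_weight hs₀ hu) (lt_of_threshold_le hκ hΛ)
    have hx0 : 0 < ‖x‖ := by linarith
    have h1 := rpow_le_one_add_sq_rpow (α := 2 * s) hx
    have h2 := one_add_log_le_log_one_add_sq hx
    have hl := Real.log_nonneg hx
    have h3 := hρK x
    rw [show -s = -(2 * s) / 2 by ring] at h3
    rw [barrier_eq_rpow hx, show -((N : ℝ) + 2 * s) = -(2 * s) + -N by ring, Real.rpow_add hx0]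
    calc _ = K * (2 ^ (-|2 * s| / 2) * ‖x‖ ^ (-(2 * s))) * (2 / 5 * (1 + Real.log ‖x‖)) *
          ‖x‖ ^ (-(N : ℝ)) := by ring
      _ ≤ K * (1 + ‖x‖ ^ 2) ^ (-(2 * s) / 2) * Real.log (1 + ‖x‖ ^ 2) * ‖x‖ ^ (-(N : ℝ)) := by
          gcongr
      _ ≤ _ := by gcongr
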